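/- Let $(\Omega,\mathcal E,P)$ be a probability space, $\mathcal F\subseteq\mathcal E$ a sub-$\sigma$-algebra, $L^0(\mathcal F)$ (resp. $L^0(\mathcal E)$) the algebra of a.s.-equivalence classes of real $\mathcal F$- (resp. $\mathcal E$-) measurable random variables with the a.s. order, and $E[\cdot\,|\,\mathcal F]$ the generalized conditional expectation ($E[x|\mathcal F]=E[x^+|\mathcal F]-E[x^-|\mathcal F]$ whenever $E[|x|\,|\,\mathcal F]<\infty$ a.s.). Let $L^2_{\mathcal F}(\mathcal E)=\{x\in L^0(\mathcal E):E[x^2|\mathcal F]<\infty\text{ a.s.}\}$, an $L^0(\mathcal F)$-module with $L^0$-norm $|||x|||_2=E[x^2|\mathcal F]^{1/2}$. On a submodule of it, and on $L^0(\mathcal F)$ with $L^0$-norm $|\cdot|$, the $(\varepsilon,\lambda)$-topology is the topology of convergence in probability of the $L^0$-norm. Fix a real number $\beta>0$. For $x\in L^2_{\mathcal F}(\mathcal E)$ put $$U_\beta(x)=-E[x|\mathcal F]+\tfrac{\beta}{2}E\big[(x-E[x|\mathcal F])^2\,\big|\,\mathcal F\big],\qquad U_\beta^*(y)=\bigvee\{E[xy|\mathcal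 F]-U_\beta(x):x\in L^2_{\mathcal F}(\mathcal E)\},$$ $$V_\beta(x)=\bigvee\{E[xy|\mathcal F]-U^*_\beta(y): y\in L^2_{\mathcal F}(\mathcal E),\ y\le 0,\ E[y|\mathcal F]=-1\}$$ (essential suprema), and let $k_x$ be the unique element of $L^0(\mathcal F)$ with $E[(k_x-x)^+|\mathcal F]=\frac1\beta$. Let $V'_\beta(x)$ be the $L^0$-Gâteaux derivative of $V_\beta$ at $x$: the $(\varepsilon,\lambda)$-continuous $L^0(\mathcal F)$-linear map $L^2_{\mathcal F}(\mathcal E)\to L^0(\mathcal F)$ such that $\frac1t\big(V_\beta(x+th)-V_\beta(x)\big)\to V'_\beta(x)(h)$ in probability as $t\downarrow0$, for every $h\in L^2_{\mathcal F}(\mathcal E)$. Let $M$ be an $(\varepsilon,\lambda)$-closed $L^0(\mathcal F)$-submodule of $L^2_{\mathcal F}(\mathcal E)$ with $L^0(\mathcal F)\subseteq M$, let $\pi:M\to L^0(\mathcal F)$ be an $(\varepsilon,\lambda)$-continuous $L^0(\mathcal F)$-module homomorphism, and suppose that $r^f\in L^0(\mathcal F)$ satisfies $r^f>0$ a.s.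 and $\pi(r^f)=1$. Let $R_\pi=\{x\in M:\pi(x)=1\}$, and call $x^*\in R_\pi$ a solution if $V_\beta(x^*)\le V_\beta(x)$ a.s. for every $x\in R_\pi$. **Theorem 4.6.** The objects above are well defined: for every $x\in L^2_{\mathcal F}(\mathcal E)$ there is exactly one $k_x$, the supremum $V_\beta(x)$ exists in $L^0(\mathcal F)$, and $V'_\beta(x)$ exists; and the supremum $U_\beta^*(y)$ exists in $L^0(\mathcal F)$ for all $y\le0$ in $L^2_{\mathcal F}(\mathcal E)$ with $E[y|\mathcal F]=-1$. 1. A return $x^*\in R_\pi$ is a solution if and only if $-\frac1{r^f}\cdot V'_\beta(x^*)|_M=\pi$. 2. Suppose moreover that $M$ is a sublattice of $L^2_{\mathcal F}(\mathcal E)$, i.e. $|x|\in M$ for every $x\in M$. If $x^*$ and $y^*$ are solutions, then $x^*\wedge k_{x^*}=y^*\wedge k_{y^*}$ and $k_{x^*}=k_{y^*}$. Furthermore, for every solution $x^*$, $V'_\beta(x^*)|_M=V'_\beta(x^*)$ in the following sense: there is $v\in M$ with $V'_\beta(x^*)(y)=E[vy|\mathcal F]$ for all $y\in L^2_{\mathcal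 F}(\mathcal E)$, and $v$ is the only element of $M$ that represents the restriction $V'_\beta(x^*)|_M$ in this way. -/

import Mathlib

open MeasureTheory Filter Topology
open scoped ENNReal

noncomputable section

namespace RandomL2

section Ring

variable {Ω : Type*} {m0 : MeasurableSpace Ω} {P : Measure Ω}

/-- The ring structure of `L⁰(ℰ)` (classes of a.s. equal real random variables), induced by the
pointwise operations. Mathlib already has its additive group, monoid, module and lattice
structures. -/
instance instCommRingL0 : CommRing (Ω →ₘ[P] ℝ) :=
  { (inferInstance : AddCommGroup (Ω →ₘ[P] ℝ)), (inferInstance : CommMonoid (Ω →ₘ[P] ℝ)) with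
    left_distrib := fun a b c => by
      refine AEEqFun.induction_on₃ a b c fun f hf g hg h hh => ?_
      simp only [AEEqFun.mk_add_mk, AEEqFun.mk_mul_mk, mul_add]
    right_distrib := fun a b c => by
      refine AEEqFun.induction_on₃ a b c fun f hf g hg h hh => ?_
      simp only [AEEqFun.mk_add_mk, AEEqFun.mk_mul_mk, add_mul]
    zero_mul := fun a => by
      refine AEEqFun.induction_on a fun f hf => ?_
      rw [AEEqFun.zero_def, AEEqFun.mk_mul_mk]
      congr 1
      ext ω
      simp
    mul_zero := fun a => by
      refine AEEqFun.induction_on a fun f hf => ?_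
      rw [AEEqFun.zero_def, AEEqFun.mk_mul_mk]
      congr 1
      ext ω
      simp }

instance instAlgebraL0 : Algebra ℝ (Ω →ₘ[P] ℝ) :=
  Algebra.ofModule
    (fun r a b => by
      refine AEEqFun.induction_on₂ a b fun f hf g hg => ?_
      simp only [AEEqFun.smul_mk, AEEqFun.mk_mul_mk, smul_mul_assoc])
    (fun r a b => by
      refine AEEqFun.induction_on₂ a b fun f hf g hg => ?_
      simp only [AEEqFun.smul_mk, AEEqFun.mk_mul_mk, mul_smul_comm])

end Ring

variable {Ω : Type*} (m : MeasurableSpace Ω) {m0 : MeasurableSpace Ω}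

/-- `L⁰(ℱ)`, as the algebra of those classes in `L⁰(ℰ)` that have an `ℱ`-measurable
representative (`ℱ = m`, `ℰ = m0`). -/
def L0 (P : Measure Ω) : Subalgebra ℝ (Ω →ₘ[P] ℝ) where
  carrier := {f | AEStronglyMeasurable[m] f P}
  mul_mem' := fun {a b} ha hb => (AEStronglyMeasurable.mul ha hb).congr (AEEqFun.coeFn_mul a b).symm
  add_mem' := fun {a b} ha hb => (AEStronglyMeasurable.add ha hb).congr (AEEqFun.coeFn_add a b).symm
  algebraMap_mem' := fun r => by
    have h : (algebraMap ℝ (Ω →ₘ[P] ℝ) r : Ω → ℝ) =ᵐ[P] fun _ => r := by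
      rw [Algebra.algebraMap_eq_smul_one]
      filter_upwards [AEEqFun.coeFn_smul r (1 : Ω →ₘ[P] ℝ),
        AEEqFun.coeFn_one (α := Ω) (β := ℝ) (μ := P)] with ω h1 h2
      simp [h1, h2]
    exact (aestronglyMeasurable_const (b := r)).congr h.symm

variable {P : Measure Ω}

/-- The generalized conditional expectation `E[x | ℱ] = E[x⁺ | ℱ] - E[x⁻ | ℱ]`, each term being
the conditional expectation of a `[0,∞]`-valued random variable. It is meaningful when
`E[|x| | ℱ] < ∞` a.s. -/
def condE (x : Ω →ₘ[P] ℝ) : L0 m P :=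
  ⟨AEEqFun.mk (fun ω => (condLExp m P (fun ω' => ENNReal.ofReal (x ω')) ω).toReal
      - (condLExp m P (fun ω' => ENNReal.ofReal (-x ω')) ω).toReal)
    (((measurable_condLExp' m P _).ennreal_toReal.sub
      (measurable_condLExp' m P _).ennreal_toReal).aestronglyMeasurable), by
    have h : StronglyMeasurable[m]
        (fun ω => (condLExp m P (fun ω' => ENNReal.ofReal (x ω')) ω).toReal
          - (condLExp m P (fun ω' => ENNReal.ofReal (-x ω')) ω).toReal) :=
      (((measurable_condLExp m P _).ennreal_toReal.sub
        (measurable_condLExp m P _).ennreal_toReal)).stronglyMeasurable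
    exact ⟨_, h, AEEqFun.coeFn_mk _ _⟩⟩

/-- Pull-out property, needed to see that `L²_ℱ(ℰ)` is an `L⁰(ℱ)`-module. -/
theorem condLExp_mul_of_measurable [IsFiniteMeasure P] (hm : m ≤ m0) (g X : Ω → ℝ≥0∞)
    (hg : Measurable[m] g) (hX : AEMeasurable X P) :
    (fun ω => g ω * condLExp m P X ω) =ᵐ[P] condLExp m P (fun ω => g ω * X ω) := by
  have key : (P.withDensity (condLExp m P X)).trim hm = (P.withDensity X).trim hm := by
    refine @Measure.ext _ m _ _ fun s hs => ?_
    rw [trim_measurableSet_eq hm hs, trim_measurableSet_eq hm hs, withDensity_apply _ (hm s hs),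
      withDensity_apply _ (hm s hs), setLIntegral_condLExp hm P X hs]
  refine ae_eq_condLExp hm P _ (hg.mul (measurable_condLExp m P X)) fun s hs => ?_
  have hgs : Measurable[m] (s.indicator g) := hg.indicator hs
  have h1 : ∀ Y : Ω → ℝ≥0∞, AEMeasurable Y P →
      ∫⁻ ω in s, g ω * Y ω ∂P = ∫⁻ ω, s.indicator g ω ∂((P.withDensity Y).trim hm) := by
    intro Y hY
    rw [lintegral_trim hm hgs,
      lintegral_withDensity_eq_lintegral_mul₀ hY (hgs.mono hm le_rfl).aemeasurable,
      ← lintegral_indicator (hm s hs)]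
    refine lintegral_congr fun ω => ?_
    by_cases h : ω ∈ s <;> simp [h, mul_comm]
  rw [h1 _ (measurable_condLExp' m P X).aemeasurable, h1 _ hX, key]

/-- `L²_ℱ(ℰ) = {x ∈ L⁰(ℰ) : E[|x|² | ℱ] ∈ L⁰₊(ℱ)}`, a module over `L⁰(ℱ)`. -/
def L2 (P : Measure Ω) [IsProbabilityMeasure P] : Submodule (L0 m P) (Ω →ₘ[P] ℝ) where
  carrier := {x | ∀ᵐ ω ∂P, condLExp m P (fun ω' => ‖x ω'‖ₑ ^ 2) ω < ∞}
  zero_mem' := by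
    have h : (fun ω' => ‖(0 : Ω →ₘ[P] ℝ) ω'‖ₑ ^ 2) =ᵐ[P] 0 := by
      filter_upwards [AEEqFun.coeFn_zero (α := Ω) (β := ℝ) (μ := P)] with ω h
      simp [h]
    filter_upwards [condLExp_congr_ae (mΩ := m) h] with ω h
    rw [h, condLExp_zero]
    simp
  add_mem' := fun {a b} ha hb => by
    have hle : (fun ω' => ‖(a + b) ω'‖ₑ ^ 2) ≤ᵐ[P]
        (2 : ℝ≥0∞) • ((fun ω' => ‖a ω'‖ₑ ^ 2) + fun ω' => ‖b ω'‖ₑ ^ 2) := by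
      filter_upwards [AEEqFun.coeFn_add a b] with ω h
      rw [h]
      simp only [Pi.add_apply, Pi.smul_apply, smul_eq_mul]
      have h2 := ENNReal.rpow_add_le_mul_rpow_add_rpow ‖a ω‖ₑ ‖b ω‖ₑ (p := 2) (by norm_num)
      norm_num at h2
      exact (pow_le_pow_left' (enorm_add_le _ _) 2).trans h2
    have hA : AEMeasurable (fun ω' => ‖a ω'‖ₑ ^ 2) P := a.aestronglyMeasurable.enorm.pow_const 2
    filter_upwards [ha, hb, condLExp_mono (mΩ := m) hle, condLExp_add_left (mΩ := m)
      (fun ω' => ‖b ω'‖ₑ ^ 2) hA, condLExp_smul' (mΩ := m) (P := P)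
      ((fun ω' => ‖a ω'‖ₑ ^ 2) + fun ω' => ‖b ω'‖ₑ ^ 2) (c := 2) (by norm_num)]
      with ω h1 h2 h3 h4 h5
    refine h3.trans_lt ?_
    rw [h5, Pi.smul_apply, h4, smul_eq_mul]
    exact ENNReal.mul_lt_top (by norm_num) (ENNReal.add_lt_top.2 ⟨h1, h2⟩)
  smul_mem' := fun c x hx => by
    by_cases hm : m ≤ m0
    · obtain ⟨c', hc', hcc⟩ : AEStronglyMeasurable[m] (c : Ω →ₘ[P] ℝ) P := c.2
      have hg : Measurable[m] (fun ω => ‖c' ω‖ₑ ^ 2) := by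
        have h1 : Measurable[m] (fun ω => ‖c' ω‖ₑ) := @Measurable.comp _ _ _ m _ _ _ _
          measurable_enorm hc'.measurable
        simp only [pow_two]
        exact h1.mul h1
      have hX : AEMeasurable (fun ω' => ‖x ω'‖ₑ ^ 2) P := x.aestronglyMeasurable.enorm.pow_const 2
      have he : (fun ω' => ‖(c • x) ω'‖ₑ ^ 2) =ᵐ[P] fun ω' => ‖c' ω'‖ₑ ^ 2 * ‖x ω'‖ₑ ^ 2 := by
        have h0 : c • x = (c : Ω →ₘ[P] ℝ) * x := rfl
        rw [h0]
        filter_upwards [AEEqFun.coeFn_mul (c : Ω →ₘ[P] ℝ) x, hcc] with ω h1 h2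
        rw [h1, Pi.mul_apply, h2, enorm_mul, mul_pow]
      filter_upwards [hx, condLExp_congr_ae (mΩ := m) he,
        condLExp_mul_of_measurable m hm _ _ hg hX] with ω h1 h2 h3
      rw [h2, ← h3]
      exact ENNReal.mul_lt_top (by simp) h1
    · simp [condLExp_of_not_le hm]

variable [IsProbabilityMeasure P]

theorem one_mem_L2 : (1 : Ω →ₘ[P] ℝ) ∈ L2 m P := by
  have h : (fun ω' => ‖(1 : Ω →ₘ[P] ℝ) ω'‖ₑ ^ 2) =ᵐ[P] fun _ => 1 := by
    filter_upwards [AEEqFun.coeFn_one (α := Ω) (β := ℝ) (μ := P)] with ω h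
    simp [h]
  have h2 : ∫⁻ ω, ‖(1 : Ω →ₘ[P] ℝ) ω‖ₑ ^ 2 ∂P ≠ ∞ := by
    rw [lintegral_congr_ae h]
    simp
  exact condLExp_lt_top h2

variable {m}

/-- The inclusion `L⁰(ℱ) ⊆ L²_ℱ(ℰ)`. -/
def ofL0 (ξ : L0 m P) : L2 m P :=
  ⟨ξ, by simpa [Algebra.smul_def] using (L2 m P).smul_mem ξ (one_mem_L2 m)⟩

/-- The `L⁰`-inner product `(x, y) = E[xy | ℱ]`. -/
def ip (x y : L2 m P) : L0 m P := condE m ((x : Ω →ₘ[P] ℝ) * y)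

/-- The `L⁰`-norm `|||x|||₂ = E[|x|² | ℱ]^{1/2}` (a representative). -/
def l2norm (x : L2 m P) : Ω → ℝ :=
  fun ω => Real.sqrt ((condE m (|(x : Ω →ₘ[P] ℝ)| ^ 2) : Ω →ₘ[P] ℝ) ω)

/-- The `L⁰`-norm of the module `L⁰(ℱ)`, i.e. the absolute value (a representative). -/
def l0norm (ξ : L0 m P) : Ω → ℝ := fun ω => |(ξ : Ω →ₘ[P] ℝ) ω|

variable (P) in
/-- The `(ε,λ)`-topology: the sets `x + {z : P(‖z‖ < ε) > 1 - λ}`, `ε > 0`, `0 < λ < 1`, are the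
basic neighbourhoods of `x`. -/
@[reducible] def epsLam {E : Type*} [AddCommGroup E] (nrm : E → Ω → ℝ) : TopologicalSpace E where
  IsOpen W := ∀ x ∈ W, ∃ ε > 0, ∃ l ∈ Set.Ioo (0 : ℝ) 1,
    ∀ y, P.real {ω | nrm (y - x) ω < ε} > 1 - l → y ∈ W
  isOpen_univ := fun _ _ => ⟨1, one_pos, 1 / 2, ⟨by norm_num, by norm_num⟩, fun _ _ => trivial⟩
  isOpen_inter := by
    rintro U V hU hV x ⟨hxU, hxV⟩
    obtain ⟨e, he, l, hl, h⟩ := hU x hxU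
    obtain ⟨e', he', l', hl', h'⟩ := hV x hxV
    refine ⟨min e e', lt_min he he', min l l',
      ⟨lt_min hl.1 hl'.1, (min_le_left _ _).trans_lt hl.2⟩, fun y hy => ⟨h y ?_, h' y ?_⟩⟩
    · have h1 : P.real {ω | nrm (y - x) ω < min e e'} ≤ P.real {ω | nrm (y - x) ω < e} :=
        measureReal_mono fun ω hω => by
          simp only [Set.mem_ofPred_eq] at hω ⊢
          exact hω.trans_le (min_le_left e e')
      linarith [min_le_left l l']
    · have h1 : P.real {ω | nrm (y - x) ω < min e e'} ≤ P.real {ω | nrm (y - x) ω < e'} :=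
        measureReal_mono fun ω hω => by
          simp only [Set.mem_ofPred_eq] at hω ⊢
          exact hω.trans_le (min_le_right e e')
      linarith [min_le_right l l']
  isOpen_sUnion := by
    rintro S hS x ⟨U, hU, hxU⟩
    obtain ⟨e, he, l, hl, h⟩ := hS U hU x hxU
    exact ⟨e, he, l, hl, fun y hy => ⟨U, hU, h y hy⟩⟩

/-- Continuity, for the `(ε,λ)`-topologies, of a module homomorphism defined on a submodule `N` of
`L²_ℱ(ℰ)`: membership in the random conjugate space `N*`. -/
def InConjugate (N : Submodule (L0 m P) (L2 m P)) (φ : N →ₗ[L0 m P] L0 m P) : Prop :=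
  @Continuous N (L0 m P) (epsLam P fun x : N => l2norm (x : L2 m P)) (epsLam P l0norm) φ

open Classical in
/-- The supremum in `L⁰(ℱ)` of a set that has one. -/
def l0Sup (S : Set (L0 m P)) : L0 m P := if h : ∃ s, IsLUB S s then h.choose else 0

/-- The conditional variance `D[x | ℱ] = E[(x - E[x | ℱ])² | ℱ]`. -/
def condVar (x : L2 m P) : L0 m P :=
  condE m (((x : Ω →ₘ[P] ℝ) - ((condE m (x : Ω →ₘ[P] ℝ) : L0 m P) : Ω →ₘ[P] ℝ)) ^ 2)

/-- The conditional mean-variance risk measure `U_β`. -/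
def meanVar (β : ℝ) (x : L2 m P) : L0 m P := -condE m (x : Ω →ₘ[P] ℝ) + (β / 2) • condVar x

/-- The set whose supremum is the random conjugate `U*_β(y)`, where `y ∈ L²_ℱ(ℰ)` stands for the
element `E[· y | ℱ]` of the random conjugate space. -/
def meanVarConjSet (β : ℝ) (y : L2 m P) : Set (L0 m P) := Set.range fun x => ip x y - meanVar β x

/-- The random conjugate `U*_β(y)`, at those `y` where it is finite. -/
def meanVarConj (β : ℝ) (y : L2 m P) : L0 m P := l0Sup (meanVarConjSet β y)

variable (m P) in
/-- `𝒫_c⁰ ∩ 𝒟`: the `y ∈ L²_ℱ(ℰ)` with `y ≤ 0` and `E[y | ℱ] = -1`. -/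
def dualSet : Set (L2 m P) := {y | (y : Ω →ₘ[P] ℝ) ≤ 0 ∧ condE m (y : Ω →ₘ[P] ℝ) = -1}

/-- The set whose supremum is `V_β(x)`. -/
def monMeanVarSet (β : ℝ) (x : L2 m P) : Set (L0 m P) := (fun y => ip x y - meanVarConj β y) '' dualSet m P

/-- The monotone conditional mean-variance risk measure `V_β`. -/
def monMeanVar (β : ℝ) (x : L2 m P) : L0 m P := l0Sup (monMeanVarSet β x)

/-- `g` is the `L⁰`-Gâteaux derivative of `f` at `x`: `g` is in the random conjugate space, and
`(f (x + t h) - f x) / t → g h` in probability as `t ↓ 0`, for every `h`. -/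
def HasGateauxDeriv (f : L2 m P → L0 m P) (x : L2 m P) (g : L2 m P →ₗ[L0 m P] L0 m P) : Prop :=
  InConjugate ⊤ (g.domRestrict ⊤) ∧ ∀ h : L2 m P, TendstoInMeasure P
    (fun (t : ℝ) ω => (((t⁻¹ • (f (x + t • h) - f x) : L0 m P) : Ω →ₘ[P] ℝ) : Ω → ℝ) ω) (𝓝[>] 0)
    (((g h : L0 m P) : Ω →ₘ[P] ℝ) : Ω → ℝ)

open Classical in
/-- The `L⁰`-Gâteaux derivative `f'(x)`, where it exists. -/
def gateauxDeriv (f : L2 m P → L0 m P) (x : L2 m P) : L2 m P →ₗ[L0 m P] L0 m P :=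
  if h : ∃ g, HasGateauxDeriv f x g then h.choose else 0

/-- `k` solves `E[(k - x)⁺ | ℱ] = 1/β`. -/
def IsK (β : ℝ) (x : L2 m P) (k : L0 m P) : Prop :=
  condE m (((k : Ω →ₘ[P] ℝ) - (x : Ω →ₘ[P] ℝ)) ⊔ 0) = algebraMap ℝ (L0 m P) (1 / β)

open Classical in
/-- `k_x`, the unique solution of `E[(k - x)⁺ | ℱ] = 1/β`. -/
def kOf (β : ℝ) (x : L2 m P) : L0 m P := if h : ∃ k, IsK β x k then h.choose else 0

/-- `1 / ξ`, pointwise. -/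
def recip (ξ : L0 m P) : L0 m P :=
  ⟨AEEqFun.compMeasurable (fun t : ℝ => t⁻¹) measurable_inv ξ, by
    obtain ⟨g, hg, hge⟩ : AEStronglyMeasurable[m] (ξ : Ω →ₘ[P] ℝ) P := ξ.2
    refine ⟨fun ω => (g ω)⁻¹, hg.measurable.inv.stronglyMeasurable, ?_⟩
    filter_upwards [hge, AEEqFun.coeFn_compMeasurable (fun t : ℝ => t⁻¹) measurable_inv
      (ξ : Ω →ₘ[P] ℝ)] with ω h1 h2
    rw [h2, Function.comp_apply, h1]⟩

/-- The set of returns `R_π = {x ∈ M : π(x) = 1}`. -/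
def returns (M : Submodule (L0 m P) (L2 m P)) (π : M →ₗ[L0 m P] L0 m P) : Set (L2 m P) :=
  {x | ∃ h : x ∈ M, π ⟨x, h⟩ = 1}

/-- `x` solves the problem of minimizing `V_β` over `R_π`: `V_β(x)` is the least value, in the
order of `L⁰(ℱ)`. -/
def IsSolution (β : ℝ) (M : Submodule (L0 m P) (L2 m P)) (π : M →ₗ[L0 m P] L0 m P)
    (x : L2 m P) : Prop :=
  x ∈ returns M π ∧ IsMinOn (monMeanVar β) (returns M π) x

/-- `v ∈ N` is the Riesz representative of the functional `φ` on `N`: `φ = E[v · | ℱ]` there. -/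
def IsRieszRep (N : Submodule (L0 m P) (L2 m P)) (φ : N →ₗ[L0 m P] L0 m P) (v : L2 m P) : Prop :=
  v ∈ N ∧ ∀ y : N, φ y = ip v y

end RandomL2

end

open RandomL2

open MeasureTheory Filter Topology
open scoped ENNReal

noncomputable section

namespace RandomL2

/-! ### The ordered ring of random variables -/

section Order

variable {Ω : Type*} {m0 : MeasurableSpace Ω} {P : Measure Ω}

/-! Everything is read off from an explicit maximizer of a strongly concave dual problem, with E[xy
| ℱ] (`ip`) used as an inner product with values in the ring `L0 m P`.

For E[y | ℱ] = -1, completing the square gives U*_β(y) = E[(y+1)² | ℱ]/(2β). Hence V_β(x) is the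
supremum of `dualObj β x y` = E[xy | ℱ] - E[(y+1)² | ℱ]/(2β) over `dualSet`. With p = (k - x)⁺ and
E[p | ℱ] = 1/β, the candidate w = -βp is feasible, and `dualObj_dualOpt_sub` computes the exact gap
to another y as E[(y-w)² | ℱ]/(2β) - E[(x-k)⁺y | ℱ]. Both contributions are nonnegative when y ≤ 0,
so w is the maximizer, and the quadratic term makes it unique; uniqueness of k follows. Existence of
k (`exists_isK`) is a measurable intermediate value argument for the map sending q to E[(q-x)⁺ | ℱ].

Write g(x) for the maximizer at x. The objective is affine in x, so g(x) is a subgradient of V_β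
(`ip_gradient_le`). The quadratic gap gives the matching upper bound with error βE[h² | ℱ]
(`le_ip_gradient_add`). Squeezing the difference quotients shows V'_β(x) = E[g(x) · | ℱ].

At a solution the two bounds force g(x*) to be orthogonal to ker π. Since h - π(h)r^f lies in ker π
and E[g | ℱ] = -1, this means E[gh | ℱ] = -r^f π(h) on M; the converse is the subgradient
inequality. If M is a sublattice, g(x*) itself lies in M, so the restricted functional determines
it. Two solutions then share g, hence (k-x)⁺; pairing g with the solutions recovers k, and x ∧ k = k
- (k-x)⁺. -/

theorem coeFn_nonneg {x : Ω →ₘ[P] ℝ} : 0 ≤ x ↔ ∀ᵐ ω ∂P, 0 ≤ x ω := by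
  rw [← AEEqFun.coeFn_le]
  constructor <;> intro h <;>
    filter_upwards [h, AEEqFun.coeFn_zero (α := Ω) (β := ℝ) (μ := P)] with ω h1 h2
  · simpa [h2] using h1
  · simpa [h2] using h1

instance instIsOrderedRingL0 : IsOrderedRing (Ω →ₘ[P] ℝ) := by
  have : IsOrderedAddMonoid (Ω →ₘ[P] ℝ) := ⟨fun a b h c => by
    rw [← AEEqFun.coeFn_le] at h ⊢
    filter_upwards [h, AEEqFun.coeFn_add a c, AEEqFun.coeFn_add b c] with ω h h1 h2
    simp only [h1, h2, Pi.add_apply]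
    linarith, fun a b h c => by
    rw [← AEEqFun.coeFn_le] at h ⊢
    filter_upwards [h, AEEqFun.coeFn_add c a, AEEqFun.coeFn_add c b] with ω h h1 h2
    simp only [h1, h2, Pi.add_apply]
    linarith⟩
  have : ZeroLEOneClass (Ω →ₘ[P] ℝ) := ⟨by
    rw [coeFn_nonneg]
    filter_upwards [AEEqFun.coeFn_one (α := Ω) (β := ℝ) (μ := P)] with ω h
    simp [h]⟩
  refine IsOrderedRing.of_mul_nonneg fun a b ha hb => ?_
  rw [coeFn_nonneg] at *
  filter_upwards [ha, hb, AEEqFun.coeFn_mul a b] with ω h1 h2 h3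
  rw [h3]
  exact mul_nonneg h1 h2

theorem algebraMap_ae (r : ℝ) : (algebraMap ℝ (Ω →ₘ[P] ℝ) r : Ω → ℝ) =ᵐ[P] fun _ => r := by
  rw [Algebra.algebraMap_eq_smul_one]
  filter_upwards [AEEqFun.coeFn_smul r (1 : Ω →ₘ[P] ℝ),
    AEEqFun.coeFn_one (α := Ω) (β := ℝ) (μ := P)] with ω h1 h2
  simp [h1, h2]

end Order

/-! ### Calculus of the generalized conditional expectation -/

section CondE

variable {Ω : Type*} {m m0 : MeasurableSpace Ω} {P : Measure Ω}

theorem L0.nonneg_iff {a : L0 m P} : 0 ≤ a ↔ ∀ᵐ ω ∂P, 0 ≤ (a : Ω →ₘ[P] ℝ) ω :=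
  coeFn_nonneg (x := (a : Ω →ₘ[P] ℝ))

theorem L0.le_iff {a b : L0 m P} :
    a ≤ b ↔ ∀ᵐ ω ∂P, (a : Ω →ₘ[P] ℝ) ω ≤ (b : Ω →ₘ[P] ℝ) ω :=
  (AEEqFun.coeFn_le (f := (a : Ω →ₘ[P] ℝ)) (g := b)).symm

theorem L0.ext_ae {a b : L0 m P} (h : (a : Ω →ₘ[P] ℝ) =ᵐ[P] (b : Ω →ₘ[P] ℝ)) : a = b :=
  Subtype.ext (AEEqFun.ext h)

theorem L0.coeFn_add (a b : L0 m P) : ((a + b : L0 m P) : Ω →ₘ[P] ℝ) =ᵐ[P]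
    fun ω => (a : Ω →ₘ[P] ℝ) ω + (b : Ω →ₘ[P] ℝ) ω :=
  AEEqFun.coeFn_add (a : Ω →ₘ[P] ℝ) (b : Ω →ₘ[P] ℝ)

theorem L0.coeFn_sub (a b : L0 m P) : ((a - b : L0 m P) : Ω →ₘ[P] ℝ) =ᵐ[P]
    fun ω => (a : Ω →ₘ[P] ℝ) ω - (b : Ω →ₘ[P] ℝ) ω :=
  AEEqFun.coeFn_sub (a : Ω →ₘ[P] ℝ) (b : Ω →ₘ[P] ℝ)

theorem L0.coeFn_mul (a b : L0 m P) : ((a * b : L0 m P) : Ω →ₘ[P] ℝ) =ᵐ[P]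
    fun ω => (a : Ω →ₘ[P] ℝ) ω * (b : Ω →ₘ[P] ℝ) ω :=
  AEEqFun.coeFn_mul (a : Ω →ₘ[P] ℝ) (b : Ω →ₘ[P] ℝ)

theorem L0.coeFn_smul (r : ℝ) (a : L0 m P) : ((r • a : L0 m P) : Ω →ₘ[P] ℝ) =ᵐ[P]
    fun ω => r * (a : Ω →ₘ[P] ℝ) ω :=
  AEEqFun.coeFn_smul r (a : Ω →ₘ[P] ℝ)

theorem L0.coeFn_algebraMap (r : ℝ) :
    ((algebraMap ℝ (L0 m P) r : L0 m P) : Ω →ₘ[P] ℝ) =ᵐ[P] fun _ => r :=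
  algebraMap_ae r

theorem L0.mul_self_nonneg (x : Ω →ₘ[P] ℝ) : 0 ≤ x * x := by
  rw [coeFn_nonneg]
  filter_upwards [AEEqFun.coeFn_mul x x] with ω h
  rw [h]
  exact _root_.mul_self_nonneg _

theorem L0.algebraMap_nonneg {r : ℝ} (hr : 0 ≤ r) : 0 ≤ algebraMap ℝ (L0 m P) r := by
  rw [L0.nonneg_iff]
  filter_upwards [algebraMap_ae (P := P) r] with ω h
  exact hr.trans_eq h.symm

theorem L0.exists_measurable (a : L0 m P) :
    ∃ g : Ω → ℝ, Measurable[m] g ∧ (a : Ω →ₘ[P] ℝ) =ᵐ[P] g := by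
  obtain ⟨g, hg, h⟩ : AEStronglyMeasurable[m] (a : Ω →ₘ[P] ℝ) P := a.2
  exact ⟨g, hg.measurable, h⟩

/-- The class of an `ℱ`-measurable function. -/
def L0.mk (hm : m ≤ m0) (g : Ω → ℝ) (hg : Measurable[m] g) : L0 m P :=
  ⟨AEEqFun.mk g (hg.mono hm le_rfl).aestronglyMeasurable, g, hg.stronglyMeasurable,
    AEEqFun.coeFn_mk _ _⟩

theorem L0.coeFn_mk (hm : m ≤ m0) (g : Ω → ℝ) (hg : Measurable[m] g) :
    ((L0.mk hm g hg : L0 m P) : Ω →ₘ[P] ℝ) =ᵐ[P] g :=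
  AEEqFun.coeFn_mk _ _

variable (m) in
/-- `E[|x| | ℱ] < ∞` almost surely. -/
def CondIntegrable (x : Ω →ₘ[P] ℝ) : Prop :=
  ∀ᵐ ω ∂P, condLExp m P (fun ω' => ‖x ω'‖ₑ) ω < ∞

theorem condE_ae (x : Ω →ₘ[P] ℝ) : ((condE m x : L0 m P) : Ω →ₘ[P] ℝ) =ᵐ[P] fun ω =>
    (condLExp m P (fun ω' => ENNReal.ofReal (x ω')) ω).toReal
      - (condLExp m P (fun ω' => ENNReal.ofReal (-x ω')) ω).toReal :=
  AEEqFun.coeFn_mk _ _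

theorem aemeasurable_ofReal (x : Ω →ₘ[P] ℝ) :
    AEMeasurable (fun ω => ENNReal.ofReal (x ω)) P :=
  x.aemeasurable.ennreal_ofReal

theorem aemeasurable_ofReal_neg (x : Ω →ₘ[P] ℝ) :
    AEMeasurable (fun ω => ENNReal.ofReal (-x ω)) P :=
  x.aemeasurable.neg.ennreal_ofReal

theorem CondIntegrable.mono {x y : Ω →ₘ[P] ℝ} (hy : CondIntegrable m y)
    (h : ∀ᵐ ω ∂P, |x ω| ≤ |y ω|) : CondIntegrable m x := by
  have h' : (fun ω => ‖x ω‖ₑ) ≤ᵐ[P] fun ω => ‖y ω‖ₑ := by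
    filter_upwards [h] with ω h
    exact enorm_le_iff_norm_le.2 h
  filter_upwards [hy, condLExp_mono (mΩ := m) h'] with ω h1 h2
  exact h2.trans_lt h1

theorem CondIntegrable.ofReal {x : Ω →ₘ[P] ℝ} (hx : CondIntegrable m x) :
    ∀ᵐ ω ∂P, condLExp m P (fun ω' => ENNReal.ofReal (x ω')) ω < ∞ := by
  have h' : (fun ω => ENNReal.ofReal (x ω)) ≤ᵐ[P] fun ω => ‖x ω‖ₑ :=
    ae_of_all _ fun ω => by
      simp only [Real.enorm_eq_ofReal_abs]
      exact ENNReal.ofReal_le_ofReal (le_abs_self _)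
  filter_upwards [hx, condLExp_mono (mΩ := m) h'] with ω h1 h2
  exact h2.trans_lt h1

theorem CondIntegrable.ofReal_neg {x : Ω →ₘ[P] ℝ} (hx : CondIntegrable m x) :
    ∀ᵐ ω ∂P, condLExp m P (fun ω' => ENNReal.ofReal (-x ω')) ω < ∞ := by
  have h' : (fun ω => ENNReal.ofReal (-x ω)) ≤ᵐ[P] fun ω => ‖x ω‖ₑ :=
    ae_of_all _ fun ω => by
      simp only [Real.enorm_eq_ofReal_abs]
      exact ENNReal.ofReal_le_ofReal (neg_le_abs _)
  filter_upwards [hx, condLExp_mono (mΩ := m) h'] with ω h1 h2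
  exact h2.trans_lt h1

theorem CondIntegrable.add {x y : Ω →ₘ[P] ℝ} (hx : CondIntegrable m x)
    (hy : CondIntegrable m y) : CondIntegrable m (x + y) := by
  have h' : (fun ω => ‖(x + y) ω‖ₑ) ≤ᵐ[P] (fun ω => ‖x ω‖ₑ) + fun ω => ‖y ω‖ₑ := by
    filter_upwards [AEEqFun.coeFn_add x y] with ω h
    rw [h]
    exact enorm_add_le _ _
  filter_upwards [hx, hy, condLExp_mono (mΩ := m) h', condLExp_add_left (mΩ := m)
    (fun ω => ‖y ω‖ₑ) x.aestronglyMeasurable.enorm] with ω h1 h2 h3 h4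
  rw [h4] at h3
  exact h3.trans_lt (ENNReal.add_lt_top.2 ⟨h1, h2⟩)

theorem condE_nonneg {x : Ω →ₘ[P] ℝ} (hx : 0 ≤ x) : 0 ≤ condE m x := by
  rw [L0.nonneg_iff]
  have h : (fun ω => ENNReal.ofReal (-x ω)) =ᵐ[P] 0 := by
    filter_upwards [coeFn_nonneg.1 hx] with ω h
    simpa using h
  filter_upwards [condE_ae (m := m) x, condLExp_congr_ae (mΩ := m) h] with ω h1 h2
  rw [h1, h2, condLExp_zero]
  simp

/-- Any decomposition of x as a difference f - g of nonnegative functions with finite conditional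
expectations computes `condE`. The relation is stated additively because subtraction truncates in
`ℝ≥0∞`. Additivity and the pull-out rule both rest on this. -/
theorem condE_ae_eq {x : Ω →ₘ[P] ℝ} (hx : CondIntegrable m x) {f g : Ω → ℝ≥0∞}
    (hf : AEMeasurable f P)
    (hf' : ∀ᵐ ω ∂P, condLExp m P f ω < ∞) (hg' : ∀ᵐ ω ∂P, condLExp m P g ω < ∞)
    (h : ∀ᵐ ω ∂P, ENNReal.ofReal (x ω) + g ω = f ω + ENNReal.ofReal (-x ω)) :
    ((condE m x : L0 m P) : Ω →ₘ[P] ℝ) =ᵐ[P] fun ω =>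
      (condLExp m P f ω).toReal - (condLExp m P g ω).toReal := by
  have h1 : (fun ω => ENNReal.ofReal (x ω)) + g =ᵐ[P] f + fun ω => ENNReal.ofReal (-x ω) := h
  filter_upwards [condE_ae (m := m) x, condLExp_congr_ae (mΩ := m) h1,
    condLExp_add_left (mΩ := m) g (aemeasurable_ofReal x),
    condLExp_add_left (mΩ := m) (fun ω => ENNReal.ofReal (-x ω)) hf, hf', hg',
    hx.ofReal, hx.ofReal_neg] with ω h2 h3 h4 h5 h6 h7 h8 h9
  rw [h4, h5, Pi.add_apply, Pi.add_apply] at h3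
  have h10 := congrArg ENNReal.toReal h3
  rw [ENNReal.toReal_add h8.ne h7.ne, ENNReal.toReal_add h6.ne h9.ne] at h10
  rw [h2]
  linarith

theorem condE_add {x y : Ω →ₘ[P] ℝ} (hx : CondIntegrable m x) (hy : CondIntegrable m y) :
    condE m (x + y) = condE m x + condE m y := by
  apply L0.ext_ae
  have hf := condLExp_add_left (mΩ := m) (fun ω => ENNReal.ofReal (y ω)) (aemeasurable_ofReal x)
  have hg := condLExp_add_left (mΩ := m) (fun ω => ENNReal.ofReal (-y ω))
    (aemeasurable_ofReal_neg x)
  have key := condE_ae_eq (hx.add hy)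
    (f := (fun ω => ENNReal.ofReal (x ω)) + fun ω => ENNReal.ofReal (y ω))
    (g := (fun ω => ENNReal.ofReal (-x ω)) + fun ω => ENNReal.ofReal (-y ω))
    ((aemeasurable_ofReal x).add (aemeasurable_ofReal y))
    (by
      filter_upwards [hf, hx.ofReal, hy.ofReal] with ω h h1 h2
      rw [h]
      exact ENNReal.add_lt_top.2 ⟨h1, h2⟩)
    (by
      filter_upwards [hg, hx.ofReal_neg, hy.ofReal_neg] with ω h h1 h2
      rw [h]
      exact ENNReal.add_lt_top.2 ⟨h1, h2⟩)
    (by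
      filter_upwards [AEEqFun.coeFn_add x y] with ω h
      rw [h, Pi.add_apply, Pi.add_apply, Pi.add_apply,
        ← ENNReal.toReal_eq_toReal_iff' (by simp) (by simp)]
      simp only [ne_eq, ENNReal.ofReal_ne_top, not_false_eq_true, ENNReal.toReal_add,
        ENNReal.toReal_ofReal', ENNReal.add_eq_top, or_self]
      -- Rewriting a⁺ as a + a⁻ leaves an identity that is polynomial in the values and their
      -- negative parts.
      have e (a : ℝ) : max a 0 = a + max (-a) 0 := by grind
      rw [e (x ω), e (y ω), e (x ω + y ω)]
      ring)
  have h0 := AEEqFun.coeFn_add ((condE m x : L0 m P) : Ω →ₘ[P] ℝ) (condE m y : L0 m P)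
  filter_upwards [key, condE_ae (m := m) x, condE_ae (m := m) y, hf, hg, hx.ofReal, hy.ofReal,
    hx.ofReal_neg, hy.ofReal_neg, h0] with ω h1 h2 h3 h4 h5 h6 h7 h8 h9 h10
  refine h1.trans (Eq.trans ?_ h10.symm)
  rw [Pi.add_apply, h2, h3, h4, h5, Pi.add_apply, Pi.add_apply, ENNReal.toReal_add h6.ne h7.ne,
    ENNReal.toReal_add h8.ne h9.ne]
  ring

theorem CondIntegrable.neg {x : Ω →ₘ[P] ℝ} (hx : CondIntegrable m x) :
    CondIntegrable m (-x) :=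
  hx.mono (by filter_upwards [AEEqFun.coeFn_neg x] with ω h; simp [h])

variable [IsProbabilityMeasure P]

theorem CondIntegrable.mul (hm : m ≤ m0) (c : L0 m P) {x : Ω →ₘ[P] ℝ}
    (hx : CondIntegrable m x) : CondIntegrable m ((c : Ω →ₘ[P] ℝ) * x) := by
  obtain ⟨g, hg, hcg⟩ := L0.exists_measurable c
  have h' : (fun ω => ‖((c : Ω →ₘ[P] ℝ) * x) ω‖ₑ) =ᵐ[P] fun ω => ‖g ω‖ₑ * ‖x ω‖ₑ := by
    filter_upwards [AEEqFun.coeFn_mul (c : Ω →ₘ[P] ℝ) x, hcg] with ω h h2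
    rw [h, Pi.mul_apply, h2, enorm_mul]
  have hg' : Measurable[m] (fun ω => ‖g ω‖ₑ) := measurable_enorm.comp hg
  filter_upwards [hx, condLExp_congr_ae (mΩ := m) h',
    condLExp_mul_of_measurable m hm _ _ hg' x.aestronglyMeasurable.enorm] with ω h1 h2 h3
  rw [h2, ← h3]
  exact ENNReal.mul_lt_top (by simp) h1

/-- Splitting both factors by sign writes cx as (c⁺x⁺ + c⁻x⁻) - (c⁺x⁻ + c⁻x⁺), and the
`[0,∞]`-valued pull-out property applies to each of the four products. -/
theorem condE_mul (hm : m ≤ m0) (c : L0 m P) {x : Ω →ₘ[P] ℝ} (hx : CondIntegrable m x) :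
    condE m ((c : Ω →ₘ[P] ℝ) * x) = c * condE m x := by
  apply L0.ext_ae
  obtain ⟨u, hu, hcu⟩ := L0.exists_measurable c
  have hp : Measurable[m] (fun ω => ENNReal.ofReal (u ω)) := hu.ennreal_ofReal
  have hn : Measurable[m] (fun ω => ENNReal.ofReal (-u ω)) := hu.neg.ennreal_ofReal
  have hpp := condLExp_mul_of_measurable m hm _ _ hp (aemeasurable_ofReal x)
  have hpn := condLExp_mul_of_measurable m hm _ _ hp (aemeasurable_ofReal_neg x)
  have hnp := condLExp_mul_of_measurable m hm _ _ hn (aemeasurable_ofReal x)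
  have hnn := condLExp_mul_of_measurable m hm _ _ hn (aemeasurable_ofReal_neg x)
  have mpp : AEMeasurable (fun ω => ENNReal.ofReal (u ω) * ENNReal.ofReal (x ω)) P :=
    (hp.mono hm le_rfl).aemeasurable.mul (aemeasurable_ofReal x)
  have mpn : AEMeasurable (fun ω => ENNReal.ofReal (u ω) * ENNReal.ofReal (-x ω)) P :=
    (hp.mono hm le_rfl).aemeasurable.mul (aemeasurable_ofReal_neg x)
  have mnn : AEMeasurable (fun ω => ENNReal.ofReal (-u ω) * ENNReal.ofReal (-x ω)) P :=
    (hn.mono hm le_rfl).aemeasurable.mul (aemeasurable_ofReal_neg x)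
  have hf := condLExp_add_left (mΩ := m)
    (fun ω => ENNReal.ofReal (-u ω) * ENNReal.ofReal (-x ω)) mpp
  have hg := condLExp_add_left (mΩ := m)
    (fun ω => ENNReal.ofReal (-u ω) * ENNReal.ofReal (x ω)) mpn
  have key := condE_ae_eq (hx.mul hm c) (mpp.add mnn)
    (g := (fun ω => ENNReal.ofReal (u ω) * ENNReal.ofReal (-x ω)) +
      fun ω => ENNReal.ofReal (-u ω) * ENNReal.ofReal (x ω))
    (by
      filter_upwards [hf, hpp, hnn, hx.ofReal, hx.ofReal_neg] with ω h h1 h2 h3 h4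
      rw [h, Pi.add_apply, ← h1, ← h2]
      exact ENNReal.add_lt_top.2 ⟨ENNReal.mul_lt_top (by simp) h3, ENNReal.mul_lt_top (by simp) h4⟩)
    (by
      filter_upwards [hg, hpn, hnp, hx.ofReal, hx.ofReal_neg] with ω h h1 h2 h3 h4
      rw [h, Pi.add_apply, ← h1, ← h2]
      exact ENNReal.add_lt_top.2 ⟨ENNReal.mul_lt_top (by simp) h4, ENNReal.mul_lt_top (by simp) h3⟩)
    (by
      filter_upwards [AEEqFun.coeFn_mul (c : Ω →ₘ[P] ℝ) x, hcu] with ω h h'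
      rw [h, Pi.mul_apply, h', Pi.add_apply, Pi.add_apply,
        ← ENNReal.toReal_eq_toReal_iff' (by simp [ENNReal.mul_eq_top])
          (by simp [ENNReal.mul_eq_top])]
      simp only [ne_eq, ENNReal.ofReal_ne_top, not_false_eq_true, ENNReal.toReal_add,
        ENNReal.toReal_ofReal', ENNReal.add_eq_top, or_self, ENNReal.toReal_mul,
        ENNReal.mul_eq_top, and_false, false_and]
      have e (a : ℝ) : max a 0 = a + max (-a) 0 := by grind
      rw [e (x ω), e (u ω), e (u ω * x ω)]
      ring)
  have h0 := AEEqFun.coeFn_mul (c : Ω →ₘ[P] ℝ) (condE m x : L0 m P)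
  filter_upwards [key, condE_ae (m := m) x, hf, hg, hx.ofReal, hx.ofReal_neg, h0, hpp, hpn, hnp,
    hnn, hcu] with ω h1 h2 h3 h4 h5 h6 h7 h8 h9 h10 h11 h12
  refine h1.trans (Eq.trans ?_ h7.symm)
  rw [Pi.mul_apply, h2, h3, h4, Pi.add_apply, Pi.add_apply, ← h8, ← h9, ← h10, ← h11,
    ENNReal.toReal_add (ENNReal.mul_lt_top (by simp) h5).ne (ENNReal.mul_lt_top (by simp) h6).ne,
    ENNReal.toReal_add (ENNReal.mul_lt_top (by simp) h6).ne (ENNReal.mul_lt_top (by simp) h5).ne,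
    h12]
  simp only [ENNReal.toReal_mul, ENNReal.toReal_ofReal']
  have e (a : ℝ) : max a 0 = a + max (-a) 0 := by grind
  rw [e (u ω)]
  ring

/-- Integrating the conditional expectation gives the integral of x, and a nonnegative function with
zero integral vanishes a.s. This makes `ip` definite. -/
theorem eq_zero_of_condE_eq_zero (hm : m ≤ m0) {x : Ω →ₘ[P] ℝ} (hx : CondIntegrable m x)
    (h0 : 0 ≤ x) (h : condE m x = 0) : x = 0 := by
  have h' : (fun ω => ENNReal.ofReal (-x ω)) =ᵐ[P] 0 := by
    filter_upwards [coeFn_nonneg.1 h0] with ω h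
    simpa using h
  have hc : ((condE m x : L0 m P) : Ω →ₘ[P] ℝ) =ᵐ[P] 0 := by
    rw [h]
    exact AEEqFun.coeFn_zero
  have h1 : condLExp m P (fun ω' => ENNReal.ofReal (x ω')) =ᵐ[P] 0 := by
    filter_upwards [condE_ae (m := m) x, condLExp_congr_ae (mΩ := m) h', hc, hx.ofReal]
      with ω h1 h2 h3 h4
    rw [h3, h2, condLExp_zero] at h1
    simp only [Pi.zero_apply, ENNReal.toReal_zero, sub_zero] at h1
    exact ((ENNReal.toReal_eq_zero_iff _).1 h1.symm).resolve_right h4.ne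
  have h2 : ∫⁻ ω, ENNReal.ofReal (x ω) ∂P = 0 := by
    rw [← lintegral_condLExp hm P, lintegral_congr_ae h1]
    simp
  rw [lintegral_eq_zero_iff' (aemeasurable_ofReal x)] at h2
  apply AEEqFun.ext
  filter_upwards [h2, coeFn_nonneg.1 h0, AEEqFun.coeFn_zero (α := Ω) (β := ℝ) (μ := P)]
    with ω h3 h4 h5
  rw [h5]
  exact le_antisymm (by simpa using h3) h4

theorem condIntegrable_one : CondIntegrable m (1 : Ω →ₘ[P] ℝ) := by
  refine condLExp_lt_top ?_
  have h : (fun ω' => ‖(1 : Ω →ₘ[P] ℝ) ω'‖ₑ) =ᵐ[P] fun _ => 1 := by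
    filter_upwards [AEEqFun.coeFn_one (α := Ω) (β := ℝ) (μ := P)] with ω h
    simp [h]
  rw [lintegral_congr_ae h]
  simp

theorem condE_one (hm : m ≤ m0) : condE m (1 : Ω →ₘ[P] ℝ) = 1 := by
  apply L0.ext_ae
  have h : (fun ω' => ENNReal.ofReal ((1 : Ω →ₘ[P] ℝ) ω')) =ᵐ[P] 1 := by
    filter_upwards [AEEqFun.coeFn_one (α := Ω) (β := ℝ) (μ := P)] with ω h
    simp [h]
  have h' : (fun ω' => ENNReal.ofReal (-(1 : Ω →ₘ[P] ℝ) ω')) =ᵐ[P] 0 := by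
    filter_upwards [AEEqFun.coeFn_one (α := Ω) (β := ℝ) (μ := P)] with ω h
    simp [h]
  filter_upwards [condE_ae (m := m) (1 : Ω →ₘ[P] ℝ), condLExp_congr_ae (mΩ := m) h,
    condLExp_congr_ae (mΩ := m) h', AEEqFun.coeFn_one (α := Ω) (β := ℝ) (μ := P)] with ω h1 h2 h3 h4
  refine h1.trans (Eq.trans ?_ h4.symm)
  rw [h2, h3, condLExp_zero, condLExp_one hm]
  simp

theorem condIntegrable_coe (hm : m ≤ m0) (c : L0 m P) : CondIntegrable m (c : Ω →ₘ[P] ℝ) := by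
  simpa using condIntegrable_one.mul hm c

theorem condE_coe (hm : m ≤ m0) (c : L0 m P) : condE m (c : Ω →ₘ[P] ℝ) = c := by
  have h := condE_mul hm c condIntegrable_one
  rwa [mul_one, condE_one hm, mul_one] at h

theorem condE_neg (hm : m ≤ m0) {x : Ω →ₘ[P] ℝ} (hx : CondIntegrable m x) :
    condE m (-x) = -condE m x := by
  have h := condE_mul hm (-1) hx
  simpa using h

theorem condE_sub (hm : m ≤ m0) {x y : Ω →ₘ[P] ℝ} (hx : CondIntegrable m x)
    (hy : CondIntegrable m y) : condE m (x - y) = condE m x - condE m y := by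
  rw [sub_eq_add_neg, condE_add hx hy.neg, condE_neg hm hy, sub_eq_add_neg]

theorem condE_mono (hm : m ≤ m0) {x y : Ω →ₘ[P] ℝ} (hx : CondIntegrable m x)
    (hy : CondIntegrable m y) (h : x ≤ y) : condE m x ≤ condE m y := by
  rw [← sub_nonneg, ← condE_sub hm hy hx]
  exact condE_nonneg (sub_nonneg.2 h)

end CondE

section Instances

variable {Ω : Type*} {m m0 : MeasurableSpace Ω} {P : Measure Ω} [IsProbabilityMeasure P]

/-! Shortcuts for instance search. -/

@[reducible] def commRingL0 : CommRing (L0 m P) := inferInstance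

@[reducible] def addCommGroupL2 : AddCommGroup (L2 m P) := inferInstance

@[reducible] def moduleL2 : Module (L0 m P) (L2 m P) := inferInstance

@[reducible] def smulL2 : SMul (L0 m P) (L2 m P) := inferInstance

end Instances

attribute [local instance] commRingL0 addCommGroupL2 moduleL2 smulL2

/-! ### The conditional inner product -/

section InnerProduct

variable {Ω : Type*} {m m0 : MeasurableSpace Ω} {P : Measure Ω} [IsProbabilityMeasure P]

theorem mem_L2_iff {x : Ω →ₘ[P] ℝ} : x ∈ L2 m P ↔ CondIntegrable m (x * x) := by
  have h : (fun ω => ‖(x * x) ω‖ₑ) =ᵐ[P] fun ω => ‖x ω‖ₑ ^ 2 := by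
    filter_upwards [AEEqFun.coeFn_mul x x] with ω h
    rw [h, Pi.mul_apply, enorm_mul, pow_two]
  have h' := condLExp_congr_ae (mΩ := m) h
  constructor <;> intro hx <;> filter_upwards [hx, h'] with ω h1 h2
  · rwa [h2]
  · rwa [← h2]

theorem L2.condIntegrable_mul (x y : L2 m P) :
    CondIntegrable m ((x : Ω →ₘ[P] ℝ) * (y : Ω →ₘ[P] ℝ)) := by
  refine ((mem_L2_iff.1 x.2).add (mem_L2_iff.1 y.2)).mono ?_
  filter_upwards [AEEqFun.coeFn_mul (x : Ω →ₘ[P] ℝ) x, AEEqFun.coeFn_mul (y : Ω →ₘ[P] ℝ) y,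
    AEEqFun.coeFn_mul (x : Ω →ₘ[P] ℝ) y,
    AEEqFun.coeFn_add ((x : Ω →ₘ[P] ℝ) * (x : Ω →ₘ[P] ℝ))
      ((y : Ω →ₘ[P] ℝ) * (y : Ω →ₘ[P] ℝ))] with ω h1 h2 h3 h4
  rw [h4, Pi.add_apply, h1, h2, h3]
  simp only [Pi.mul_apply]
  rw [abs_of_nonneg (a := _ + _) (add_nonneg (mul_self_nonneg _) (mul_self_nonneg _)), abs_le]
  constructor <;> nlinarith [sq_nonneg ((x : Ω →ₘ[P] ℝ) ω + (y : Ω →ₘ[P] ℝ) ω),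
    sq_nonneg ((x : Ω →ₘ[P] ℝ) ω - (y : Ω →ₘ[P] ℝ) ω)]

theorem L2.condIntegrable (x : L2 m P) : CondIntegrable m (x : Ω →ₘ[P] ℝ) := by
  simpa using L2.condIntegrable_mul x ⟨1, one_mem_L2 m⟩

theorem mem_L2_of_abs_le {x : Ω →ₘ[P] ℝ} (y : L2 m P)
    (h : ∀ᵐ ω ∂P, |x ω| ≤ |(y : Ω →ₘ[P] ℝ) ω|) : x ∈ L2 m P := by
  refine mem_L2_iff.2 ((mem_L2_iff.1 y.2).mono ?_)
  filter_upwards [h, AEEqFun.coeFn_mul x x, AEEqFun.coeFn_mul (y : Ω →ₘ[P] ℝ) y] with ω h h1 h2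
  rw [h1, h2, Pi.mul_apply, Pi.mul_apply, abs_mul, abs_mul]
  gcongr

theorem coe_ofL0 (ξ : L0 m P) : ((ofL0 ξ : L2 m P) : Ω →ₘ[P] ℝ) = ξ := rfl

theorem ofL0_eq_smul (ξ : L0 m P) : (ofL0 ξ : L2 m P) = ξ • ofL0 1 :=
  Subtype.ext (by
    change (ξ : Ω →ₘ[P] ℝ) = (ξ : Ω →ₘ[P] ℝ) * 1
    rw [mul_one])

theorem L2.coe_smul (c : L0 m P) (x : L2 m P) :
    ((c • x : L2 m P) : Ω →ₘ[P] ℝ) = (c : Ω →ₘ[P] ℝ) * x := rfl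

theorem L2.real_smul_eq (r : ℝ) (x : L2 m P) : r • x = algebraMap ℝ (L0 m P) r • x := by
  rw [algebraMap_smul]

theorem ip_comm (x y : L2 m P) : ip x y = ip y x := by
  rw [ip, mul_comm, ip]

theorem ip_add_left (x y z : L2 m P) : ip (x + y) z = ip x z + ip y z := by
  rw [ip, Submodule.coe_add, add_mul,
    condE_add (L2.condIntegrable_mul x z) (L2.condIntegrable_mul y z), ip, ip]

theorem ip_add_right (x y z : L2 m P) : ip z (x + y) = ip z x + ip z y := by
  rw [ip_comm, ip_add_left, ip_comm x, ip_comm y]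

theorem ip_nonneg {x y : L2 m P} (hx : 0 ≤ (x : Ω →ₘ[P] ℝ)) (hy : 0 ≤ (y : Ω →ₘ[P] ℝ)) :
    0 ≤ ip x y :=
  condE_nonneg (mul_nonneg hx hy)

theorem ip_self_nonneg (x : L2 m P) : 0 ≤ ip x x := condE_nonneg (L0.mul_self_nonneg _)

theorem ip_one_right (x : L2 m P) : ip x (ofL0 1) = condE m (x : Ω →ₘ[P] ℝ) := by
  have h : ((ofL0 (1 : L0 m P) : L2 m P) : Ω →ₘ[P] ℝ) = 1 := rfl
  rw [ip, h, mul_one]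

variable (hm : m ≤ m0)
include hm

theorem ip_smul_left (c : L0 m P) (x y : L2 m P) : ip (c • x) y = c * ip x y := by
  rw [ip, L2.coe_smul, mul_assoc, condE_mul hm c (L2.condIntegrable_mul x y), ip]

theorem ip_smul_right (c : L0 m P) (x y : L2 m P) : ip x (c • y) = c * ip x y := by
  rw [ip_comm, ip_smul_left hm, ip_comm]

theorem ip_neg_left (x y : L2 m P) : ip (-x) y = -ip x y := by
  rw [← neg_one_smul (L0 m P) x, ip_smul_left hm, neg_one_mul]

theorem ip_neg_right (x y : L2 m P) : ip x (-y) = -ip x y := by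
  rw [ip_comm, ip_neg_left hm, ip_comm]

theorem ip_sub_left (x y z : L2 m P) : ip (x - y) z = ip x z - ip y z := by
  rw [sub_eq_add_neg, ip_add_left, ip_neg_left hm, sub_eq_add_neg]

theorem ip_sub_right (x y z : L2 m P) : ip z (x - y) = ip z x - ip z y := by
  rw [sub_eq_add_neg, ip_add_right, ip_neg_right hm, sub_eq_add_neg]

theorem ip_self_eq_zero {x : L2 m P} (h : ip x x = 0) : x = 0 := by
  have h1 := eq_zero_of_condE_eq_zero hm (L2.condIntegrable_mul x x) (L0.mul_self_nonneg _) h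
  apply Subtype.ext
  apply AEEqFun.ext
  have h2 := AEEqFun.coeFn_mul (x : Ω →ₘ[P] ℝ) x
  rw [h1] at h2
  filter_upwards [h2, AEEqFun.coeFn_zero (α := Ω) (β := ℝ) (μ := P)] with ω h3 h4
  rw [h4] at h3
  exact (mul_self_eq_zero.1 h3.symm).trans h4.symm

theorem ip_one_one : ip (ofL0 1 : L2 m P) (ofL0 1) = 1 := by
  rw [ip_one_right]
  exact condE_one hm

/-- Conditional Cauchy–Schwarz, by the discriminant of the quadratic t ↦ E[(tx+y)² | ℱ].
Nonnegativity is first taken at rational t only, so that one null set serves for all t. -/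
theorem ip_sq_le (x y : L2 m P) : ∀ᵐ ω ∂P,
    ((ip x y : L0 m P) : Ω →ₘ[P] ℝ) ω ^ 2 ≤
      ((ip x x : L0 m P) : Ω →ₘ[P] ℝ) ω * ((ip y y : L0 m P) : Ω →ₘ[P] ℝ) ω := by
  have h : ∀ q : ℚ, ∀ᵐ ω ∂P, 0 ≤ ((ip x x : L0 m P) : Ω →ₘ[P] ℝ) ω * ((q : ℝ) * q) +
      2 * ((ip x y : L0 m P) : Ω →ₘ[P] ℝ) ω * q + ((ip y y : L0 m P) : Ω →ₘ[P] ℝ) ω := by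
    intro q
    set a := algebraMap ℝ (L0 m P) q
    have h0 := ip_self_nonneg (a • x + y)
    have h1 : ip (a • x + y) (a • x + y) =
        ip x x * (a * a) + (a * ip x y + a * ip x y) + ip y y := by
      simp only [ip_add_left, ip_add_right, ip_smul_left hm, ip_smul_right hm, ip_comm y x]
      ring
    rw [h1, L0.nonneg_iff] at h0
    filter_upwards [h0, L0.coeFn_add (ip x x * (a * a) + (a * ip x y + a * ip x y)) (ip y y),
      L0.coeFn_add (ip x x * (a * a)) (a * ip x y + a * ip x y),
      L0.coeFn_add (a * ip x y) (a * ip x y), L0.coeFn_mul (ip x x) (a * a), L0.coeFn_mul a a,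
      L0.coeFn_mul a (ip x y), algebraMap_ae (P := P) (q : ℝ)] with ω h0 h1 h2 h3 h4 h5 h6 h7
    have h7' : (a : Ω →ₘ[P] ℝ) ω = q := h7
    rw [h1, h2, h3, h4, h5, h6, h7'] at h0
    linarith
  filter_upwards [ae_all_iff.2 h] with ω h
  set A := ((ip x x : L0 m P) : Ω →ₘ[P] ℝ) ω
  set B := ((ip x y : L0 m P) : Ω →ₘ[P] ℝ) ω
  set C := ((ip y y : L0 m P) : Ω →ₘ[P] ℝ) ω
  have h' : ∀ t : ℝ, 0 ≤ A * (t * t) + 2 * B * t + C := by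
    intro t
    have hc : IsClosed {t : ℝ | 0 ≤ A * (t * t) + 2 * B * t + C} :=
      isClosed_le continuous_const (by fun_prop)
    exact (Rat.denseRange_cast (𝕜 := ℝ)).induction_on (p := fun t => 0 ≤ A * (t * t) + 2 * B * t + C)
      t hc h
  have := discrim_le_zero h'
  rw [discrim] at this
  nlinarith

end InnerProduct

/-! ### Positive parts -/

section PosPart

variable {Ω : Type*} {m m0 : MeasurableSpace Ω} {P : Measure Ω} [IsProbabilityMeasure P]

/-- The positive part of an element of `L²_ℱ(ℰ)`. -/
def L2.pos (x : L2 m P) : L2 m P :=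
  ⟨(x : Ω →ₘ[P] ℝ) ⊔ 0, mem_L2_of_abs_le x (by
    filter_upwards [AEEqFun.coeFn_sup (x : Ω →ₘ[P] ℝ) 0,
      AEEqFun.coeFn_zero (α := Ω) (β := ℝ) (μ := P)] with ω h1 h2
    rw [h1, h2, Pi.zero_apply]
    grind)⟩

theorem L2.coe_pos (x : L2 m P) : (L2.pos x : Ω →ₘ[P] ℝ) = (x : Ω →ₘ[P] ℝ) ⊔ 0 := rfl

theorem L2.coeFn_pos (x : L2 m P) :
    (L2.pos x : Ω →ₘ[P] ℝ) =ᵐ[P] fun ω => max ((x : Ω →ₘ[P] ℝ) ω) 0 := by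
  filter_upwards [AEEqFun.coeFn_sup (x : Ω →ₘ[P] ℝ) 0,
      AEEqFun.coeFn_zero (α := Ω) (β := ℝ) (μ := P)] with ω h1 h2
  rw [L2.coe_pos, h1, h2, Pi.zero_apply]

theorem L2.pos_nonneg (x : L2 m P) : 0 ≤ (L2.pos x : Ω →ₘ[P] ℝ) := le_sup_right

theorem L2.pos_sub_pos_neg (x : L2 m P) : L2.pos x - L2.pos (-x) = x := by
  apply Subtype.ext
  apply AEEqFun.ext
  filter_upwards [L2.coeFn_pos x, L2.coeFn_pos (-x), AEEqFun.coeFn_neg (x : Ω →ₘ[P] ℝ),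
    AEEqFun.coeFn_sub (L2.pos x : Ω →ₘ[P] ℝ) (L2.pos (-x) : Ω →ₘ[P] ℝ)] with ω h1 h2 h3 h4
  rw [AddSubgroupClass.coe_sub, h4, Pi.sub_apply, h1, h2, NegMemClass.coe_neg, h3, Pi.neg_apply]
  grind

theorem L2.ip_pos_pos_neg (hm : m ≤ m0) (x : L2 m P) : ip (L2.pos x) (L2.pos (-x)) = 0 := by
  have h : (L2.pos x : Ω →ₘ[P] ℝ) * L2.pos (-x) = 0 := by
    apply AEEqFun.ext
    filter_upwards [L2.coeFn_pos x, L2.coeFn_pos (-x), AEEqFun.coeFn_neg (x : Ω →ₘ[P] ℝ),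
      AEEqFun.coeFn_mul (L2.pos x : Ω →ₘ[P] ℝ) (L2.pos (-x) : Ω →ₘ[P] ℝ),
      AEEqFun.coeFn_zero (α := Ω) (β := ℝ) (μ := P)] with ω h1 h2 h3 h4 h5
    rw [h4, Pi.mul_apply, h1, h2, NegMemClass.coe_neg, h3, Pi.neg_apply, h5, Pi.zero_apply]
    rcases le_total 0 ((x : Ω →ₘ[P] ℝ) ω) with h | h
    · rw [max_eq_right (neg_nonpos.2 h), mul_zero]
    · rw [max_eq_right h, zero_mul]
  rw [ip, h]
  exact condE_coe hm 0

end PosPart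

/-! ### The dual problem: conjugate, maximizer and uniqueness of k -/

section Optimality

variable {Ω : Type*} {m m0 : MeasurableSpace Ω} {P : Measure Ω}

theorem l0Sup_eq {S : Set (L0 m P)} {s : L0 m P} (h : IsLUB S s) : l0Sup S = s := by
  have h' : ∃ s, IsLUB S s := ⟨s, h⟩
  rw [l0Sup, dif_pos h']
  exact h'.choose_spec.unique h

theorem L0.algebraMap_mul_inv {β : ℝ} (hβ : 0 < β) :
    algebraMap ℝ (L0 m P) β * algebraMap ℝ (L0 m P) β⁻¹ = 1 := by
  rw [← map_mul, mul_inv_cancel₀ hβ.ne', map_one]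

theorem L0.two_mul_half : (2 : L0 m P) * algebraMap ℝ (L0 m P) (1 / 2) = 1 := by
  rw [← map_ofNat (algebraMap ℝ (L0 m P)) 2, ← map_mul]
  norm_num

variable [IsProbabilityMeasure P]

/-- The objective `E[xy | ℱ] - E[(y + 1)² | ℱ] / (2β)` whose supremum is `V_β(x)`. -/
def dualObj (β : ℝ) (x y : L2 m P) : L0 m P :=
  ip x y - algebraMap ℝ (L0 m P) β⁻¹ * algebraMap ℝ (L0 m P) (1 / 2) *
    ip (y + ofL0 1) (y + ofL0 1)

theorem condVar_eq (x : L2 m P) :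
    condVar x = ip (x - condE m (x : Ω →ₘ[P] ℝ) • ofL0 1) (x - condE m (x : Ω →ₘ[P] ℝ) • ofL0 1) := by
  rw [← ofL0_eq_smul, condVar, ip, pow_two]
  rfl

theorem mem_dualSet_iff {y : L2 m P} :
    y ∈ dualSet m P ↔ (y : Ω →ₘ[P] ℝ) ≤ 0 ∧ ip y (ofL0 1) = -1 := by
  rw [ip_one_right]
  rfl

/-- The maximizer `-β (k - x)⁺` of the dual problem. -/
def dualOpt (β : ℝ) (x : L2 m P) (k : L0 m P) : L2 m P :=
  -(algebraMap ℝ (L0 m P) β • L2.pos (k • ofL0 1 - x))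

theorem isK_iff {β : ℝ} {x : L2 m P} {k : L0 m P} : IsK β x k ↔
    ip (L2.pos (k • ofL0 1 - x)) (ofL0 1) = algebraMap ℝ (L0 m P) β⁻¹ := by
  rw [← ofL0_eq_smul, ip_one_right, IsK, one_div]
  rfl

/-- Where the common positive part is nonzero, both k - x and k' - x equal it, so k = k' there. -/
theorem L2.sub_smul_pos_eq_zero {x : L2 m P} {k k' : L0 m P}
    (hp : L2.pos (k • ofL0 1 - x) = L2.pos (k' • ofL0 1 - x)) :
    (k - k') • L2.pos (k • ofL0 1 - x) = 0 := by
  apply Subtype.ext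
  apply AEEqFun.ext
  rw [← ofL0_eq_smul, ← ofL0_eq_smul] at hp
  rw [← ofL0_eq_smul]
  have e1 := L2.coeFn_pos (ofL0 k - x)
  have e2 := L2.coeFn_pos (ofL0 k' - x)
  rw [← hp] at e2
  filter_upwards [e1, e2, AEEqFun.coeFn_sub (k : Ω →ₘ[P] ℝ) (x : Ω →ₘ[P] ℝ),
    AEEqFun.coeFn_sub (k' : Ω →ₘ[P] ℝ) (x : Ω →ₘ[P] ℝ), L0.coeFn_sub k k',
    AEEqFun.coeFn_mul ((k - k' : L0 m P) : Ω →ₘ[P] ℝ) (L2.pos (ofL0 k - x) : Ω →ₘ[P] ℝ),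
    AEEqFun.coeFn_zero (α := Ω) (β := ℝ) (μ := P)] with ω h1 h2 h3 h4 h5 h6 h7
  rw [L2.coe_smul, h6, Pi.mul_apply, h5]
  refine Eq.trans ?_ h7.symm
  rw [AddSubgroupClass.coe_sub, coe_ofL0, h3, Pi.sub_apply] at h1
  rw [AddSubgroupClass.coe_sub, coe_ofL0, h4, Pi.sub_apply] at h2
  rw [Pi.zero_apply, mul_eq_zero]
  rcases le_total ((k : Ω →ₘ[P] ℝ) ω) ((x : Ω →ₘ[P] ℝ) ω) with h | h
  · right
    rw [h1, max_eq_right (sub_nonpos.2 h)]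
  · grind

variable (hm : m ≤ m0)
include hm

theorem meanVar_eq (β : ℝ) (x : L2 m P) : meanVar β x = -ip x (ofL0 1) +
    algebraMap ℝ (L0 m P) (1 / 2) * algebraMap ℝ (L0 m P) β *
      (ip x x - ip x (ofL0 1) * ip x (ofL0 1)) := by
  rw [meanVar, condVar_eq, Algebra.smul_def, ← ip_one_right, ← map_mul]
  simp only [ip_sub_left hm, ip_sub_right hm, ip_smul_left hm, ip_smul_right hm, ip_one_one hm,
    ip_comm (ofL0 1) x]
  rw [show β / 2 = 1 / 2 * β by ring]
  ring

theorem isGreatest_meanVarConjSet {β : ℝ} (hβ : 0 < β) {y : L2 m P}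
    (hy : ip y (ofL0 1) = -1) :
    IsGreatest (meanVarConjSet β y) (algebraMap ℝ (L0 m P) β⁻¹ * algebraMap ℝ (L0 m P) (1 / 2) *
      ip (y + ofL0 1) (y + ofL0 1)) := by
  have hB := L0.algebraMap_mul_inv (m := m) (P := P) hβ
  have hH := L0.two_mul_half (m := m) (P := P)
  have hH0 := L0.algebraMap_nonneg (m := m) (P := P) (r := 1 / 2) (by norm_num)
  have hB0 := L0.algebraMap_nonneg (m := m) (P := P) hβ.le
  have hmv := meanVar_eq hm (P := P) β
  -- `L0 m P` is not a field: β, 1/β and 1/2 become ring atoms known only through BC = 1 and 2H = 1,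
  -- which is the form `linear_combination` can use.
  generalize algebraMap ℝ (L0 m P) β = B at *
  generalize algebraMap ℝ (L0 m P) β⁻¹ = C at *
  generalize algebraMap ℝ (L0 m P) (1 / 2) = H at *
  have hy' : ip (ofL0 1) y = -1 := by rw [ip_comm, hy]
  have h11 := ip_one_one (P := P) hm
  constructor
  -- The maximizer is (y+1)/β, where the square in the upper bound below vanishes.
  · refine ⟨C • (y + ofL0 1), ?_⟩
    simp only [hmv, ip_add_left, ip_add_right, ip_smul_left hm, ip_smul_right hm, h11, hy, hy']
    linear_combination -(C * (ip y y - 1)) * (H * hB + hH)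
  · rintro _ ⟨x, rfl⟩
    -- The difference between the claimed maximum and the value at x is (β/2)E[(x - E[x | ℱ] -
    -- (y+1)/β)² | ℱ].
    have h := mul_nonneg (mul_nonneg hH0 hB0)
      (ip_self_nonneg (x - ip x (ofL0 1) • ofL0 1 - C • (y + ofL0 1)))
    rw [← sub_nonneg]
    refine h.trans_eq ?_
    simp only [hmv, ip_add_left, ip_add_right, ip_sub_left hm, ip_sub_right hm, ip_smul_left hm,
      ip_smul_right hm, h11, hy, hy', ip_comm (ofL0 1) x, ip_comm y x]
    linear_combination (H * C * (ip y y - 1) - 2 * H * (ip x y + ip x (ofL0 1))) * hB -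
      (ip x y + ip x (ofL0 1)) * hH

theorem meanVarConj_isLUB {β : ℝ} (hβ : 0 < β) {y : L2 m P} (hy : y ∈ dualSet m P) :
    IsLUB (meanVarConjSet β y) (meanVarConj β y) := by
  have h := (isGreatest_meanVarConjSet hm hβ (mem_dualSet_iff.1 hy).2).isLUB
  rwa [meanVarConj, l0Sup_eq h]

theorem ip_sub_meanVarConj {β : ℝ} (hβ : 0 < β) (x : L2 m P) {y : L2 m P}
    (hy : y ∈ dualSet m P) : ip x y - meanVarConj β y = dualObj β x y := by
  rw [meanVarConj,
    l0Sup_eq (isGreatest_meanVarConjSet hm hβ (mem_dualSet_iff.1 hy).2).isLUB, dualObj]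

theorem monMeanVarSet_eq {β : ℝ} (hβ : 0 < β) (x : L2 m P) :
    monMeanVarSet β x = dualObj β x '' dualSet m P :=
  Set.image_congr fun _ hy => ip_sub_meanVarConj hm hβ x hy

theorem dualOpt_mem {β : ℝ} (hβ : 0 < β) {x : L2 m P} {k : L0 m P} (hk : IsK β x k) :
    dualOpt β x k ∈ dualSet m P := by
  rw [mem_dualSet_iff]
  constructor
  · have h : 0 ≤ (algebraMap ℝ (L0 m P) β : Ω →ₘ[P] ℝ) *
        (L2.pos (k • ofL0 1 - x) : Ω →ₘ[P] ℝ) :=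
      mul_nonneg (L0.algebraMap_nonneg hβ.le) (L2.pos_nonneg _)
    exact neg_nonpos.2 h
  · rw [dualOpt, ip_neg_left hm, ip_smul_left hm, isK_iff.1 hk, L0.algebraMap_mul_inv hβ]

/-- Write x = k - p + n with p = (k-x)⁺ and n = (x-k)⁺, so that E[pn | ℱ] = 0. The constant k pairs
equally with all y of mean -1, and what remains is a completed square plus the complementary
slackness term in n. Only E[y | ℱ] = -1 enters; the sign of y is needed later to sign the last term.
-/
theorem dualObj_dualOpt_sub {β : ℝ} (hβ : 0 < β) {x : L2 m P} {k : L0 m P} (hk : IsK β x k)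
    {y : L2 m P} (hy : ip y (ofL0 1) = -1) :
    dualObj β x (dualOpt β x k) - dualObj β x y =
      algebraMap ℝ (L0 m P) β⁻¹ * algebraMap ℝ (L0 m P) (1 / 2) *
        ip (y - dualOpt β x k) (y - dualOpt β x k) - ip (L2.pos (x - k • ofL0 1)) y := by
  have hB := L0.algebraMap_mul_inv (m := m) (P := P) hβ
  have hH := L0.two_mul_half (m := m) (P := P)
  have hp := isK_iff.1 hk
  have hpn := L2.ip_pos_pos_neg hm (k • ofL0 1 - x)
  have hs := L2.pos_sub_pos_neg (k • ofL0 1 - x)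
  rw [neg_sub] at hpn hs
  have hx : x = k • ofL0 1 - (L2.pos (k • ofL0 1 - x) - L2.pos (x - k • ofL0 1)) := by
    rw [hs, sub_sub_cancel]
  simp only [dualObj, dualOpt]
  generalize L2.pos (k • ofL0 1 - x) = p at *
  generalize L2.pos (x - k • ofL0 1) = n at *
  subst hx
  generalize algebraMap ℝ (L0 m P) β = B at *
  generalize algebraMap ℝ (L0 m P) β⁻¹ = C at *
  generalize algebraMap ℝ (L0 m P) (1 / 2) = H at *
  have hy' : ip (ofL0 1) y = -1 := by rw [ip_comm, hy]
  have hp' : ip (ofL0 1) p = C := by rw [ip_comm, hp]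
  have hnp : ip n p = 0 := by rw [ip_comm, hpn]
  simp only [ip_add_left, ip_add_right, ip_sub_left hm, ip_sub_right hm, ip_smul_left hm,
      ip_smul_right hm, ip_neg_left hm, ip_neg_right hm, ip_one_one (P := P) hm, hy, hy', hp, hp',
      hnp, ip_comm y p]
  linear_combination (-k + 2 * C * H - 2 * H * (B * ip p p + ip p y)) * hB -
    (B * ip p p + ip p y) * hH

theorem le_dualObj_dualOpt {β : ℝ} (hβ : 0 < β) {x : L2 m P} {k : L0 m P} (hk : IsK β x k)
    {y : L2 m P} (hy : y ∈ dualSet m P) :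
    algebraMap ℝ (L0 m P) β⁻¹ * algebraMap ℝ (L0 m P) (1 / 2) *
        ip (y - dualOpt β x k) (y - dualOpt β x k) ≤
      dualObj β x (dualOpt β x k) - dualObj β x y := by
  have hy' := mem_dualSet_iff.1 hy
  have h := ip_nonneg (y := -y) (L2.pos_nonneg (x - k • ofL0 1)) (neg_nonneg.2 hy'.1)
  rw [ip_neg_right hm] at h
  rw [dualObj_dualOpt_sub hm hβ hk hy'.2]
  exact (le_sub_self_iff _).2 (neg_nonneg.1 h)

theorem isGreatest_monMeanVarSet {β : ℝ} (hβ : 0 < β) {x : L2 m P} {k : L0 m P}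
    (hk : IsK β x k) : IsGreatest (monMeanVarSet β x) (dualObj β x (dualOpt β x k)) := by
  rw [monMeanVarSet_eq hm hβ]
  refine ⟨⟨_, dualOpt_mem hm hβ hk, rfl⟩, ?_⟩
  rintro _ ⟨y, hy, rfl⟩
  rw [← sub_nonneg]
  exact (mul_nonneg (mul_nonneg (L0.algebraMap_nonneg (inv_pos.2 hβ).le)
    (L0.algebraMap_nonneg (by norm_num))) (ip_self_nonneg _)).trans (le_dualObj_dualOpt hm hβ hk hy)

theorem monMeanVar_eq {β : ℝ} (hβ : 0 < β) {x : L2 m P} {k : L0 m P}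
    (hk : IsK β x k) : monMeanVar β x = dualObj β x (dualOpt β x k) :=
  l0Sup_eq (isGreatest_monMeanVarSet hm hβ hk).isLUB

theorem monMeanVar_isLUB {β : ℝ} (hβ : 0 < β) {x : L2 m P} {k : L0 m P}
    (hk : IsK β x k) : IsLUB (monMeanVarSet β x) (monMeanVar β x) := by
  rw [monMeanVar_eq hm hβ hk]
  exact (isGreatest_monMeanVarSet hm hβ hk).isLUB

/-- Both candidates attain the same maximum, so the gap is zero and so is the squared distance it
dominates. -/
theorem IsK.dualOpt_unique {β : ℝ} (hβ : 0 < β) {x : L2 m P} {k k' : L0 m P} (hk : IsK β x k)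
    (hk' : IsK β x k') : dualOpt β x k' = dualOpt β x k := by
  have h := le_dualObj_dualOpt hm hβ hk (dualOpt_mem hm hβ hk')
  rw [← monMeanVar_eq hm hβ hk, ← monMeanVar_eq hm hβ hk', sub_self] at h
  have hB := L0.algebraMap_mul_inv (m := m) (P := P) hβ
  have hH := L0.two_mul_half (m := m) (P := P)
  have h0 := le_antisymm h (mul_nonneg (mul_nonneg (L0.algebraMap_nonneg (inv_pos.2 hβ).le)
    (L0.algebraMap_nonneg (by norm_num))) (ip_self_nonneg _))
  rw [← sub_eq_zero]
  refine ip_self_eq_zero hm ?_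
  generalize ip (dualOpt β x k' - dualOpt β x k) (dualOpt β x k' - dualOpt β x k) = q at *
  linear_combination 2 * algebraMap ℝ (L0 m P) β * h0 - q * hB -
    q * algebraMap ℝ (L0 m P) β * algebraMap ℝ (L0 m P) β⁻¹ * hH

theorem IsK.unique {β : ℝ} (hβ : 0 < β) {x : L2 m P} {k k' : L0 m P} (hk : IsK β x k)
    (hk' : IsK β x k') : k = k' := by
  have hd := hk.dualOpt_unique hm hβ hk'
  have hB : algebraMap ℝ (L0 m P) β⁻¹ * algebraMap ℝ (L0 m P) β = 1 := by
    rw [mul_comm, L0.algebraMap_mul_inv hβ]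
  have hp : L2.pos (k • ofL0 1 - x) = L2.pos (k' • ofL0 1 - x) := by
    have h := congrArg (fun z => algebraMap ℝ (L0 m P) β⁻¹ • z) (neg_injective hd)
    simp only [smul_smul, hB, one_smul] at h
    exact h.symm
  have h0 := L2.sub_smul_pos_eq_zero hp
  -- Taking E[· | ℱ] of (k-k')(k-x)⁺ = 0 gives (k-k')/β = 0.
  have h1 := ip_smul_left hm (k - k') (L2.pos (k • ofL0 1 - x)) (ofL0 1)
  rw [isK_iff.1 hk, h0, ← zero_smul (L0 m P) (0 : L2 m P), ip_smul_left hm, zero_mul] at h1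
  generalize algebraMap ℝ (L0 m P) β = B at *
  generalize algebraMap ℝ (L0 m P) β⁻¹ = C at *
  linear_combination (k' - k) * hB - B * h1

end Optimality

/-! ### Existence of k -/

section Threshold

variable {Ω : Type*} {m m0 : MeasurableSpace Ω} {P : Measure Ω}

/-- The threshold is the supremum of the rationals q with g q < c. Taken in `EReal` it exists
everywhere and is measurable; the two crossing hypotheses make it finite a.s. -/
theorem exists_threshold (g : ℚ → Ω → ℝ) (hg : ∀ q, Measurable[m] (g q)) (c : ℝ)
    (hmono : ∀ᵐ ω ∂P, ∀ q r : ℚ, q ≤ r → g q ω ≤ g r ω)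
    (hlow : ∀ᵐ ω ∂P, ∃ q, g q ω < c) (hhigh : ∀ᵐ ω ∂P, ∃ q, c ≤ g q ω) :
    ∃ k : Ω → ℝ, Measurable[m] k ∧ ∀ᵐ ω ∂P, ∀ q : ℚ,
      ((q : ℝ) < k ω → g q ω ≤ c) ∧ (k ω < q → c ≤ g q ω) := by
  classical
  let K : Ω → EReal := fun ω => ⨆ q : ℚ, if g q ω < c then ((q : ℝ) : EReal) else ⊥
  have hK : Measurable[m] K := by
    refine Measurable.iSup fun q => ?_
    exact Measurable.ite ((hg q) measurableSet_Iio) measurable_const measurable_const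
  refine ⟨fun ω => (K ω).toReal, measurable_ereal_toReal.comp hK, ?_⟩
  filter_upwards [hmono, hlow, hhigh] with ω h1 h2 h3
  have hlt : ∀ q : ℚ, ((q : ℝ) : EReal) < K ω → g q ω < c := by
    intro q hq
    obtain ⟨r, hr⟩ := lt_iSup_iff.1 hq
    split_ifs at hr with hrc
    · exact (h1 q r (by exact_mod_cast hr.le)).trans_lt hrc
    · exact absurd hr not_lt_bot
  have hge : ∀ q : ℚ, g q ω < c → ((q : ℝ) : EReal) ≤ K ω := by
    intro q hq
    refine le_trans ?_ (le_iSup (fun q : ℚ => if g q ω < c then ((q : ℝ) : EReal) else ⊥) q)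
    simp [hq]
  obtain ⟨q2, h2⟩ := h2
  obtain ⟨q3, h3⟩ := h3
  have hbot : K ω ≠ ⊥ := ((EReal.bot_lt_coe _).trans_le (hge q2 h2)).ne'
  have htop : K ω ≠ ⊤ := fun h => absurd (hlt q3 (h ▸ EReal.coe_lt_top _)) (not_lt.2 h3)
  have hreal := EReal.coe_toReal htop hbot
  intro q
  constructor
  · intro hq
    refine (hlt q ?_).le
    rw [← hreal]
    exact EReal.coe_lt_coe_iff.2 hq
  · intro hq
    by_contra hc
    have := hge q (not_le.1 hc)
    rw [← hreal, EReal.coe_le_coe_iff] at this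
    exact absurd hq (not_lt.2 this)

end Threshold

section Existence

variable {Ω : Type*} {m m0 : MeasurableSpace Ω} {P : Measure Ω} [IsProbabilityMeasure P]
  (hm : m ≤ m0)
include hm

/-- The conditional expectation is monotone on events of `ℱ`. -/
theorem condE_le_on {x y : Ω →ₘ[P] ℝ} (hx : CondIntegrable m x) (hy : CondIntegrable m y)
    {A : Set Ω} (hA : MeasurableSet[m] A) (h : ∀ᵐ ω ∂P, ω ∈ A → x ω ≤ y ω) :
    ∀ᵐ ω ∂P, ω ∈ A → ((condE m x : L0 m P) : Ω →ₘ[P] ℝ) ω ≤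
      ((condE m y : L0 m P) : Ω →ₘ[P] ℝ) ω := by
  have hg : Measurable[m] (A.indicator fun _ => (1 : ℝ)) := measurable_const.indicator hA
  set a : L0 m P := L0.mk hm _ hg with ha
  have hae : (a : Ω →ₘ[P] ℝ) =ᵐ[P] A.indicator fun _ => (1 : ℝ) := L0.coeFn_mk hm _ hg
  have hle : (a : Ω →ₘ[P] ℝ) * x ≤ (a : Ω →ₘ[P] ℝ) * y := by
    rw [← AEEqFun.coeFn_le]
    filter_upwards [h, hae, AEEqFun.coeFn_mul (a : Ω →ₘ[P] ℝ) x,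
      AEEqFun.coeFn_mul (a : Ω →ₘ[P] ℝ) y] with ω h h1 h2 h3
    rw [h2, h3, Pi.mul_apply, Pi.mul_apply, h1]
    by_cases hω : ω ∈ A
    · simpa [hω] using h hω
    · simp [hω]
  have h1 := condE_mono hm (hx.mul hm a) (hy.mul hm a) hle
  rw [condE_mul hm a hx, condE_mul hm a hy, L0.le_iff] at h1
  filter_upwards [h1, hae, L0.coeFn_mul a (condE m x), L0.coeFn_mul a (condE m y)]
    with ω h1 h2 h3 h4 hω
  rw [h3, h4, h2] at h1
  simpa [hω] using h1

/-- These bounds force the crossing of the level 1/β: (q-x)⁺ ≥ q - x for large q, and for q < 0 the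
square (x-2q)² ≥ 0 gives (q-x)⁺ ≤ x²/(4(-q)), which is small as q → -∞. -/
theorem condE_pos_sub_bounds (x : L2 m P) (q : ℝ) :
    (∀ᵐ ω ∂P, q - ((condE m (x : Ω →ₘ[P] ℝ) : L0 m P) : Ω →ₘ[P] ℝ) ω ≤
      ((condE m (L2.pos (ofL0 (algebraMap ℝ (L0 m P) q) - x) : Ω →ₘ[P] ℝ) : L0 m P) :
        Ω →ₘ[P] ℝ) ω) ∧
    (q < 0 → ∀ᵐ ω ∂P,
      ((condE m (L2.pos (ofL0 (algebraMap ℝ (L0 m P) q) - x) : Ω →ₘ[P] ℝ) : L0 m P) :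
        Ω →ₘ[P] ℝ) ω ≤ (4 * -q)⁻¹ * ((ip x x : L0 m P) : Ω →ₘ[P] ℝ) ω) := by
  set a := algebraMap ℝ (L0 m P) q with ha
  have haq : (a : Ω →ₘ[P] ℝ) =ᵐ[P] fun _ => q := L0.coeFn_algebraMap q
  have hs := AEEqFun.coeFn_sub (a : Ω →ₘ[P] ℝ) (x : Ω →ₘ[P] ℝ)
  have hp := L2.coeFn_pos (ofL0 a - x)
  constructor
  · have h := condE_mono hm (L2.condIntegrable (ofL0 a - x))
      (L2.condIntegrable (L2.pos (ofL0 a - x))) le_sup_left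
    rw [AddSubgroupClass.coe_sub, condE_sub hm (L2.condIntegrable _) (L2.condIntegrable _),
      coe_ofL0, condE_coe hm, L0.le_iff] at h
    filter_upwards [h, L0.coeFn_sub a (condE m (x : Ω →ₘ[P] ℝ)), haq] with ω h1 h2 h3
    rwa [h2, h3] at h1
  · intro hq
    set b := algebraMap ℝ (L0 m P) (4 * -q)⁻¹ with hb
    have hbq : (b : Ω →ₘ[P] ℝ) =ᵐ[P] fun _ => (4 * -q)⁻¹ := L0.coeFn_algebraMap _
    have h := condE_mono hm (L2.condIntegrable (L2.pos (ofL0 a - x)))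
      ((L2.condIntegrable_mul x x).mul hm b) (by
        rw [← AEEqFun.coeFn_le]
        filter_upwards [hp, hs, haq, hbq,
          AEEqFun.coeFn_mul (b : Ω →ₘ[P] ℝ) ((x : Ω →ₘ[P] ℝ) * (x : Ω →ₘ[P] ℝ)),
          AEEqFun.coeFn_mul (x : Ω →ₘ[P] ℝ) (x : Ω →ₘ[P] ℝ)] with ω h1 h2 h3 h4 h5 h6
        rw [h1, AddSubgroupClass.coe_sub, coe_ofL0, h2, Pi.sub_apply, h3, h5, Pi.mul_apply, h4, h6,
          Pi.mul_apply]
        have hq' : 0 < 4 * -q := by linarith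
        refine max_le ?_ (mul_nonneg (inv_pos.2 hq').le (mul_self_nonneg _))
        rw [inv_mul_eq_div, le_div_iff₀ hq']
        nlinarith [sq_nonneg ((x : Ω →ₘ[P] ℝ) ω - 2 * q), sq_nonneg ((x : Ω →ₘ[P] ℝ) ω + 2 * q)])
    rw [condE_mul hm b (L2.condIntegrable_mul x x), L0.le_iff] at h
    filter_upwards [h, L0.coeFn_mul b (ip x x), hbq] with ω h1 h2 h3
    rw [← h3]
    exact h1.trans_eq h2

theorem exists_isK {β : ℝ} (hβ : 0 < β) (x : L2 m P) : ∃ k, IsK β x k := by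
  let p : ℚ → L2 m P := fun q => L2.pos (ofL0 (algebraMap ℝ (L0 m P) q) - x)
  have hp : ∀ q : ℚ, (p q : Ω →ₘ[P] ℝ) =ᵐ[P] fun ω => max (q - (x : Ω →ₘ[P] ℝ) ω) 0 := by
    intro q
    filter_upwards [L2.coeFn_pos (ofL0 (algebraMap ℝ (L0 m P) q) - x), AEEqFun.coeFn_sub
      ((algebraMap ℝ (L0 m P) q : L0 m P) : Ω →ₘ[P] ℝ) (x : Ω →ₘ[P] ℝ),
      L0.coeFn_algebraMap (m := m) (P := P) (q : ℝ)] with ω h1 h2 h3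
    rw [h1, AddSubgroupClass.coe_sub, coe_ofL0, h2, Pi.sub_apply, h3]
  choose g hg hge using fun q => L0.exists_measurable (condE m (p q : Ω →ₘ[P] ℝ) : L0 m P)
  have hge' := ae_all_iff.2 hge
  have hmono : ∀ᵐ ω ∂P, ∀ q r : ℚ, q ≤ r → g q ω ≤ g r ω := by
    refine ae_all_iff.2 fun q => ae_all_iff.2 fun r => ?_
    by_cases hqr : q ≤ r
    · have h := condE_mono hm (L2.condIntegrable (p q)) (L2.condIntegrable (p r)) (by
        rw [← AEEqFun.coeFn_le]
        filter_upwards [hp q, hp r] with ω h1 h2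
        rw [h1, h2]
        have : (q : ℝ) ≤ r := by exact_mod_cast hqr
        gcongr)
      rw [L0.le_iff] at h
      filter_upwards [h, hge q, hge r] with ω h1 h2 h3 _
      rwa [h2, h3] at h1
    · exact ae_of_all _ fun _ h => absurd h hqr
  have hlow : ∀ᵐ ω ∂P, ∃ q, g q ω < 1 / β := by
    have h := ae_all_iff.2 fun n : ℕ =>
      (condE_pos_sub_bounds hm x ((-((n : ℚ) + 1) : ℚ) : ℝ)).2 (by push_cast; linarith)
    filter_upwards [h, hge'] with ω h1 h2
    -- With q = -(n+1) the bound E[x² | ℱ]/(4(n+1)) is then below 1/β.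
    obtain ⟨n, hn⟩ := exists_nat_gt (β * ((ip x x : L0 m P) : Ω →ₘ[P] ℝ) ω)
    refine ⟨-((n : ℚ) + 1), ?_⟩
    rw [← h2]
    refine (h1 n).trans_lt ?_
    push_cast
    rw [inv_mul_eq_div, div_lt_div_iff₀ (by linarith) hβ]
    nlinarith
  have hhigh : ∀ᵐ ω ∂P, ∃ q, 1 / β ≤ g q ω := by
    have h := ae_all_iff.2 fun q : ℚ => (condE_pos_sub_bounds hm x q).1
    filter_upwards [h, hge'] with ω h1 h2
    obtain ⟨q, hq⟩ := exists_rat_gt (1 / β + ((condE m (x : Ω →ₘ[P] ℝ) : L0 m P) : Ω →ₘ[P] ℝ) ω)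
    refine ⟨q, ?_⟩
    rw [← h2]
    exact le_trans (by linarith) (h1 q)
  obtain ⟨k, hk, hkq⟩ := exists_threshold g hg (1 / β) hmono hlow hhigh
  set κ : L0 m P := L0.mk hm k hk
  have hκ : (κ : Ω →ₘ[P] ℝ) =ᵐ[P] k := L0.coeFn_mk hm k hk
  set y := L2.pos (ofL0 κ - x) with hy
  have hyk : (y : Ω →ₘ[P] ℝ) =ᵐ[P] fun ω => max (k ω - (x : Ω →ₘ[P] ℝ) ω) 0 := by
    filter_upwards [L2.coeFn_pos (ofL0 κ - x), AEEqFun.coeFn_sub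
      (κ : Ω →ₘ[P] ℝ) (x : Ω →ₘ[P] ℝ), hκ] with ω h1 h2 h3
    rw [h1, AddSubgroupClass.coe_sub, coe_ofL0, h2, Pi.sub_apply, h3]
  have hδ : ∀ δ : ℚ, (∀ᵐ ω ∂P, ((algebraMap ℝ (L0 m P) δ : L0 m P) : Ω →ₘ[P] ℝ) ω = δ) :=
    fun δ => L0.coeFn_algebraMap _
  -- The random k is compared with a constant q on an event of ℱ where they differ by at most δ;
  -- there z ↦ (z-x)⁺, being 1-Lipschitz, changes by at most δ. Rational q and δ keep the null sets
  -- countable in number.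
  have hup : ∀ᵐ ω ∂P, ∀ q δ : ℚ, ω ∈ {ω | (q : ℝ) < k ω ∧ k ω ≤ q + δ} →
      ((condE m (y : Ω →ₘ[P] ℝ) : L0 m P) : Ω →ₘ[P] ℝ) ω ≤ g q ω + δ := by
    refine ae_all_iff.2 fun q => ae_all_iff.2 fun δ => ?_
    have h := condE_le_on hm (L2.condIntegrable y) ((L2.condIntegrable (p q)).add
      (condIntegrable_coe hm (algebraMap ℝ (L0 m P) δ)))
      (A := {ω | (q : ℝ) < k ω ∧ k ω ≤ q + δ})
      ((hk measurableSet_Ioi).inter (hk measurableSet_Iic)) (by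
        filter_upwards [hyk, hp q, hδ δ, AEEqFun.coeFn_add (p q : Ω →ₘ[P] ℝ)
          (algebraMap ℝ (L0 m P) δ : L0 m P)] with ω h1 h2 h3 h4 h5
        rw [h1, h4, Pi.add_apply, h2, h3]
        have := h5.1
        have := h5.2
        grind)
    rw [condE_add (L2.condIntegrable (p q)) (condIntegrable_coe hm _), condE_coe hm] at h
    filter_upwards [h, hge q, hδ δ, L0.coeFn_add (condE m (p q : Ω →ₘ[P] ℝ))
      (algebraMap ℝ (L0 m P) δ)] with ω h1 h2 h3 h4 h5
    have := h1 h5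
    rwa [h4, h2, h3] at this
  have hdown : ∀ᵐ ω ∂P, ∀ q δ : ℚ, ω ∈ {ω | k ω < q ∧ (q : ℝ) ≤ k ω + δ} →
      g q ω ≤ ((condE m (y : Ω →ₘ[P] ℝ) : L0 m P) : Ω →ₘ[P] ℝ) ω + δ := by
    refine ae_all_iff.2 fun q => ae_all_iff.2 fun δ => ?_
    have h := condE_le_on hm (L2.condIntegrable (p q)) ((L2.condIntegrable y).add
      (condIntegrable_coe hm (algebraMap ℝ (L0 m P) δ)))
      (A := {ω | k ω < q ∧ (q : ℝ) ≤ k ω + δ})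
      ((hk measurableSet_Iio).inter (by
        have : {ω | (q : ℝ) ≤ k ω + δ} = {ω | (q : ℝ) - δ ≤ k ω} := by ext; simp
        change MeasurableSet[m] {ω | (q : ℝ) ≤ k ω + δ}
        rw [this]
        exact hk measurableSet_Ici)) (by
        filter_upwards [hyk, hp q, hδ δ, AEEqFun.coeFn_add (y : Ω →ₘ[P] ℝ)
          (algebraMap ℝ (L0 m P) δ : L0 m P)] with ω h1 h2 h3 h4 h5
        rw [h2, h4, Pi.add_apply, h1, h3]
        have := h5.1
        have := h5.2
        grind)
    rw [condE_add (L2.condIntegrable y) (condIntegrable_coe hm _), condE_coe hm] at h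
    filter_upwards [h, hge q, hδ δ, L0.coeFn_add (condE m (y : Ω →ₘ[P] ℝ))
      (algebraMap ℝ (L0 m P) δ)] with ω h1 h2 h3 h4 h5
    have := h1 h5
    rwa [h4, h2, h3] at this
  refine ⟨κ, L0.ext_ae ?_⟩
  change ((condE m (y : Ω →ₘ[P] ℝ) : L0 m P) : Ω →ₘ[P] ℝ) =ᵐ[P] _
  filter_upwards [hkq, hup, hdown, L0.coeFn_algebraMap (m := m) (P := P) (1 / β)]
    with ω h1 h2 h3 h4
  rw [h4]
  refine le_antisymm (le_of_forall_pos_le_add fun ε hε => ?_)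
    (le_of_forall_pos_le_add fun ε hε => ?_)
  · obtain ⟨δ, hδ0, hδε⟩ := exists_rat_btwn hε
    obtain ⟨q, hq1, hq2⟩ := exists_rat_btwn (show k ω - δ < k ω by linarith)
    have := h2 q δ ⟨hq2, by linarith⟩
    linarith [(h1 q).1 hq2]
  · obtain ⟨δ, hδ0, hδε⟩ := exists_rat_btwn hε
    obtain ⟨q, hq1, hq2⟩ := exists_rat_btwn (show k ω < k ω + δ by linarith)
    have := h3 q δ ⟨hq1, by linarith⟩
    linarith [(h1 q).2 hq1]

theorem isK_kOf {β : ℝ} (hβ : 0 < β) (x : L2 m P) : IsK β x (kOf β x) := by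
  have h := exists_isK hm hβ x
  rw [kOf, dif_pos h]
  exact h.choose_spec

end Existence

/-! ### The derivative of V_β -/

section Derivative

variable {Ω : Type*} {m m0 : MeasurableSpace Ω} {P : Measure Ω} [IsProbabilityMeasure P]

theorem exists_measureReal_lt_gt (f : Ω →ₘ[P] ℝ) {δ : ℝ} (hδ : 0 < δ) :
    ∃ K > 0, 1 - δ < P.real {ω | f ω < K} := by
  have hmono : Monotone fun n : ℕ => {ω | f ω < (n : ℝ)} := fun a b hab ω hω =>
    lt_of_lt_of_le (show f ω < (a : ℝ) from hω) (by exact_mod_cast hab)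
  have hU : (⋃ n : ℕ, {ω | f ω < (n : ℝ)}) = Set.univ :=
    Set.eq_univ_of_forall fun ω => Set.mem_iUnion.2 (exists_nat_gt (f ω))
  have h := tendsto_measure_iUnion_atTop (μ := P) hmono
  rw [hU, measure_univ] at h
  have h' : Tendsto (fun n : ℕ => P.real {ω | f ω < (n : ℝ)}) atTop (𝓝 1) :=
    (ENNReal.tendsto_toReal ENNReal.one_ne_top).comp h
  obtain ⟨n, hn, hn0⟩ := ((h'.eventually (lt_mem_nhds (show 1 - δ < 1 by linarith))).and
    (eventually_gt_atTop 0)).exists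
  exact ⟨n, by exact_mod_cast hn0, hn⟩

variable (hm : m ≤ m0)
include hm

theorem abs_ip_le (x y : L2 m P) : ∀ᵐ ω ∂P,
    |((ip x y : L0 m P) : Ω →ₘ[P] ℝ) ω| ≤
      √(((ip x x : L0 m P) : Ω →ₘ[P] ℝ) ω) * l2norm y ω := by
  have e : |(y : Ω →ₘ[P] ℝ)| ^ 2 = (y : Ω →ₘ[P] ℝ) * (y : Ω →ₘ[P] ℝ) := by
    apply AEEqFun.ext
    filter_upwards [AEEqFun.coeFn_pow |(y : Ω →ₘ[P] ℝ)| 2, AEEqFun.coeFn_abs (y : Ω →ₘ[P] ℝ),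
      AEEqFun.coeFn_mul (y : Ω →ₘ[P] ℝ) (y : Ω →ₘ[P] ℝ)] with ω h1 h2 h3
    rw [h1, h3, Pi.pow_apply, h2, sq_abs, Pi.mul_apply, pow_two]
  filter_upwards [ip_sq_le hm x y, L0.nonneg_iff.1 (ip_self_nonneg x)] with ω h1 h2
  rw [l2norm, e, ← Real.sqrt_mul h2]
  exact Real.abs_le_sqrt h1

/-- The functional `E[w · | ℱ]`. -/
def ipLinear (w : L2 m P) : L2 m P →ₗ[L0 m P] L0 m P where
  toFun h := ip w h
  map_add' a b := ip_add_right a b w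
  map_smul' c a := ip_smul_right hm c w a

/-- By Cauchy–Schwarz, |E[wh | ℱ]| is at most |||w|||₂ |||h|||₂, and |||w|||₂ stays below some
constant K off an event of small probability. -/
theorem inConjugate_ipLinear (w : L2 m P) : InConjugate ⊤ ((ipLinear hm w).domRestrict ⊤) := by
  rw [InConjugate]
  refine @Continuous.mk _ _ (epsLam P fun x : (⊤ : Submodule (L0 m P) (L2 m P)) =>
    l2norm (x : L2 m P)) (epsLam P l0norm) _ fun W hW x hx => ?_
  obtain ⟨ε, hε, l, hl, h⟩ := hW _ hx
  set S : Ω →ₘ[P] ℝ := AEEqFun.comp Real.sqrt Real.continuous_sqrt (ip w w : L0 m P)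
  obtain ⟨K, hK, hSK⟩ := exists_measureReal_lt_gt S (half_pos hl.1)
  -- The probability loss l is shared equally between the events |||w|||₂ < K and |||y-x|||₂ < ε/K.
  refine ⟨ε / K, by positivity, l / 2, ⟨by linarith [hl.1], by linarith [hl.2]⟩, fun y hy =>
    h _ ?_⟩
  have hA : MeasurableSet {ω | S ω < K} := S.stronglyMeasurable.measurable measurableSet_Iio
  have h1 : P.real ({ω | S ω < K} ∪ {ω | l2norm (y - x : L2 m P) ω < ε / K}) +
      P.real ({ω | S ω < K} ∩ {ω | l2norm (y - x : L2 m P) ω < ε / K}) = P.real {ω | S ω < K} +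
      P.real {ω | l2norm (y - x : L2 m P) ω < ε / K} := measureReal_union_add_inter' hA
  have h2 : P.real ({ω | S ω < K} ∪ {ω | l2norm (y - x : L2 m P) ω < ε / K}) ≤ 1 :=
    measureReal_le_one
  have h3 : P.real ({ω | S ω < K} ∩ {ω | l2norm (y - x : L2 m P) ω < ε / K}) ≤
      P.real {ω | l0norm ((ipLinear hm w).domRestrict ⊤ y - (ipLinear hm w).domRestrict ⊤ x) ω
        < ε} := by
    refine ENNReal.toReal_mono (measure_ne_top _ _) (measure_mono_ae ?_)
    filter_upwards [abs_ip_le hm w (y - x : L2 m P), AEEqFun.coeFn_comp Real.sqrt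
      Real.continuous_sqrt (ip w w : Ω →ₘ[P] ℝ)] with ω h4 h5 h6
    rw [← map_sub]
    refine lt_of_le_of_lt h4 ?_
    have h7 : √(((ip w w : L0 m P) : Ω →ₘ[P] ℝ) ω) < K := h5.symm.trans_lt h6.1
    have h8 : l2norm (y - x : L2 m P) ω < ε / K := h6.2
    calc _ ≤ K * l2norm (y - x : L2 m P) ω :=
          mul_le_mul_of_nonneg_right h7.le (Real.sqrt_nonneg _)
      _ < K * (ε / K) := by gcongr
      _ = ε := by field_simp
  have h4 : P.real {ω | l2norm (y - x : L2 m P) ω < ε / K} > 1 - l / 2 := hy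
  linarith

/-- The Riesz representative of the derivative of `V_β` at `x`. -/
def gradient (β : ℝ) (x : L2 m P) : L2 m P := dualOpt β x (kOf β x)

theorem gradient_mem {β : ℝ} (hβ : 0 < β) (x : L2 m P) : gradient β x ∈ dualSet m P :=
  dualOpt_mem hm hβ (isK_kOf hm hβ x)

theorem monMeanVar_eq_gradient {β : ℝ} (hβ : 0 < β) (x : L2 m P) :
    monMeanVar β x = dualObj β x (gradient β x) :=
  monMeanVar_eq hm hβ (isK_kOf hm hβ x)

/-- The maximizer at x is feasible at x + h, and the objective changes by exactly E[g(x)h | ℱ]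
there. -/
theorem ip_gradient_le {β : ℝ} (hβ : 0 < β) (x h : L2 m P) :
    ip (gradient β x) h ≤ monMeanVar β (x + h) - monMeanVar β x := by
  have h1 := (isGreatest_monMeanVarSet hm hβ (isK_kOf hm hβ (x + h))).2
    (monMeanVarSet_eq hm hβ (x + h) ▸ Set.mem_image_of_mem _ (gradient_mem hm hβ x))
  rw [← monMeanVar_eq hm hβ (isK_kOf hm hβ (x + h))] at h1
  rw [monMeanVar_eq_gradient hm hβ x, ← sub_nonneg]
  refine (sub_nonneg.2 h1).trans_eq ?_
  simp only [dualObj, ip_add_left x h, ip_comm h (gradient β x)]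
  ring

theorem le_ip_gradient_add {β : ℝ} (hβ : 0 < β) (x h : L2 m P) :
    monMeanVar β (x + h) - monMeanVar β x ≤
      ip (gradient β x) h + algebraMap ℝ (L0 m P) β * ip h h := by
  have h1 := le_dualObj_dualOpt hm hβ (isK_kOf hm hβ x) (gradient_mem hm hβ (x + h))
  change _ ≤ dualObj β x (gradient β x) - _ at h1
  rw [monMeanVar_eq_gradient hm hβ x, monMeanVar_eq_gradient hm hβ (x + h), ← sub_nonneg]
  have e : dualObj β (x + h) (gradient β (x + h)) =
      dualObj β x (gradient β (x + h)) + ip h (gradient β (x + h)) := by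
    simp only [dualObj, ip_add_left x h]
    ring
  rw [e]
  change algebraMap ℝ (L0 m P) β⁻¹ * algebraMap ℝ (L0 m P) (1 / 2) *
    ip (gradient β (x + h) - gradient β x) (gradient β (x + h) - gradient β x) ≤ _ at h1
  generalize gradient β (x + h) = w' at *
  generalize gradient β x = w at *
  have hB := L0.algebraMap_mul_inv (m := m) (P := P) hβ
  have hH := L0.two_mul_half (m := m) (P := P)
  have hB0 := L0.algebraMap_nonneg (m := m) (P := P) hβ.le
  have hC0 := L0.algebraMap_nonneg (m := m) (P := P) (inv_pos.2 hβ).le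
  have hH0 := L0.algebraMap_nonneg (m := m) (P := P) (r := 1 / 2) (by norm_num)
  generalize algebraMap ℝ (L0 m P) β = B at *
  generalize algebraMap ℝ (L0 m P) β⁻¹ = C at *
  generalize algebraMap ℝ (L0 m P) (1 / 2) = H at *
  -- With w and w' the maximizers at x and x + h, this square absorbs the cross term E[(w'-w)h | ℱ]
  -- into the quadratic gap `h1` at the cost of (β/2)E[h² | ℱ]. The nonnegative term `h3` fills the
  -- slack up to the constant β.
  have h2 := mul_nonneg (mul_nonneg hC0 hH0) (ip_self_nonneg ((w - w') + B • h))
  have h3 := mul_nonneg (mul_nonneg hH0 hB0) (ip_self_nonneg h)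
  refine (add_nonneg (add_nonneg (sub_nonneg.2 h1) h2) h3).trans_eq ?_
  simp only [ip_add_left, ip_add_right, ip_sub_left hm, ip_sub_right hm, ip_smul_left hm,
    ip_smul_right hm, ip_comm w' w, ip_comm w h, ip_comm w' h]
  linear_combination (2 * H * (ip h w - ip h w') + H * B * ip h h) * hB +
    (ip h w - ip h w' + B * ip h h) * hH

theorem slope_bounds {β : ℝ} (hβ : 0 < β) (x h : L2 m P) {t : ℝ} (ht : 0 < t) :
    ∀ᵐ ω ∂P, ((ip (gradient β x) h : L0 m P) : Ω →ₘ[P] ℝ) ω ≤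
        ((t⁻¹ • (monMeanVar β (x + t • h) - monMeanVar β x) : L0 m P) : Ω →ₘ[P] ℝ) ω ∧
      ((t⁻¹ • (monMeanVar β (x + t • h) - monMeanVar β x) : L0 m P) : Ω →ₘ[P] ℝ) ω ≤
        ((ip (gradient β x) h : L0 m P) : Ω →ₘ[P] ℝ) ω +
          t * (β * ((ip h h : L0 m P) : Ω →ₘ[P] ℝ) ω) := by
  have h1 := ip_gradient_le hm hβ x (t • h)
  have h2 := le_ip_gradient_add hm hβ x (t • h)
  rw [L2.real_smul_eq, ip_smul_right hm, L0.le_iff] at h1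
  rw [L2.real_smul_eq, ip_smul_right hm, ip_smul_right hm, ip_smul_left hm, L0.le_iff] at h2
  rw [L2.real_smul_eq]
  set a := algebraMap ℝ (L0 m P) t
  set D := monMeanVar β (x + a • h) - monMeanVar β x
  filter_upwards [h1, h2, L0.coeFn_smul t⁻¹ D, L0.coeFn_mul a (ip (gradient β x) h),
    L0.coeFn_algebraMap (m := m) (P := P) t,
    L0.coeFn_add (a * ip (gradient β x) h) (algebraMap ℝ (L0 m P) β * (a * (a * ip h h))),
    L0.coeFn_mul (algebraMap ℝ (L0 m P) β) (a * (a * ip h h)), L0.coeFn_mul a (a * ip h h),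
    L0.coeFn_mul a (ip h h), L0.coeFn_algebraMap (m := m) (P := P) β]
    with ω h1 h2 h3 h4 h5 h6 h7 h8 h9 h10
  rw [h4, h5] at h1
  rw [h6, h4, h7, h8, h9, h5, h10] at h2
  rw [h3, inv_mul_eq_div, le_div_iff₀ ht, div_le_iff₀ ht]
  constructor <;> linarith

theorem hasGateauxDeriv_ipLinear {β : ℝ} (hβ : 0 < β) (x : L2 m P) :
    HasGateauxDeriv (monMeanVar β) x (ipLinear hm (gradient β x)) := by
  refine ⟨inConjugate_ipLinear hm _, fun h ε hε => ?_⟩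
  -- The slope bounds hold off a null set depending on t; along a sequence there are countably many,
  -- so a.s. convergence, and hence convergence in measure, is available.
  refine tendsto_of_seq_tendsto fun u hu => ?_
  have hu0 : Tendsto u atTop (𝓝 0) := hu.mono_right nhdsWithin_le_nhds
  have hpos : ∀ᶠ n in atTop, 0 < u n := hu.eventually self_mem_nhdsWithin
  refine tendstoInMeasure_of_tendsto_ae (f := fun n ω => (((u n)⁻¹ • (monMeanVar β (x + u n • h) -
    monMeanVar β x) : L0 m P) : Ω →ₘ[P] ℝ) ω)
    (fun n => AEEqFun.aestronglyMeasurable _) ?_ ε hε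
  have hb : ∀ᵐ ω ∂P, ∀ n, 0 < u n → _ :=
    ae_all_iff.2 fun n => eventually_imp_distrib_left.2 fun hn => slope_bounds hm hβ x h hn
  filter_upwards [hb] with ω hb
  have hlim : Tendsto (fun n => ((ip (gradient β x) h : L0 m P) : Ω →ₘ[P] ℝ) ω +
      u n * (β * ((ip h h : L0 m P) : Ω →ₘ[P] ℝ) ω)) atTop
      (𝓝 (((ip (gradient β x) h : L0 m P) : Ω →ₘ[P] ℝ) ω)) := by
    simpa using tendsto_const_nhds.add (hu0.mul_const _)
  exact tendsto_of_tendsto_of_tendsto_of_le_of_le' tendsto_const_nhds hlim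
    (hpos.mono fun n hn => (hb n hn).1) (hpos.mono fun n hn => (hb n hn).2)

omit hm in
theorem HasGateauxDeriv.unique {f : L2 m P → L0 m P} {x : L2 m P} {g g' : L2 m P →ₗ[L0 m P] L0 m P}
    (h : HasGateauxDeriv f x g) (h' : HasGateauxDeriv f x g') : g = g' :=
  LinearMap.ext fun y => L0.ext_ae (tendstoInMeasure_ae_unique (h.2 y) (h'.2 y))

theorem gateauxDeriv_monMeanVar {β : ℝ} (hβ : 0 < β) (x : L2 m P) :
    gateauxDeriv (monMeanVar β) x = ipLinear hm (gradient β x) := by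
  have h : ∃ g, HasGateauxDeriv (monMeanVar β) x g := ⟨_, hasGateauxDeriv_ipLinear hm hβ x⟩
  rw [gateauxDeriv, dif_pos h]
  exact h.choose_spec.unique (hasGateauxDeriv_ipLinear hm hβ x)

end Derivative

/-! ### Solutions of the minimization problem -/

section Solutions

variable {Ω : Type*} {m m0 : MeasurableSpace Ω} {P : Measure Ω}

theorem recip_mul_self {r : L0 m P} (hr : ∀ᵐ ω ∂P, 0 < (r : Ω →ₘ[P] ℝ) ω) : recip r * r = 1 := by
  apply L0.ext_ae
  filter_upwards [hr, L0.coeFn_mul (recip r) r, AEEqFun.coeFn_compMeasurable (fun t : ℝ => t⁻¹)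
    measurable_inv (r : Ω →ₘ[P] ℝ), AEEqFun.coeFn_one (α := Ω) (β := ℝ) (μ := P)] with ω h1 h2 h3 h4
  have h3' : (recip r : Ω →ₘ[P] ℝ) ω = ((r : Ω →ₘ[P] ℝ) ω)⁻¹ := h3
  refine h2.trans (Eq.trans ?_ h4.symm)
  rw [h3', Pi.one_apply, inv_mul_cancel₀ h1.ne']

/-- Dividing by t and letting t = 1/(n+1) tend to 0 removes the second-order term. -/
theorem L0.nonneg_of_forall_mul_add_sq {a b : L0 m P} (hb : ∀ t : ℝ, 0 < t →
    0 ≤ algebraMap ℝ (L0 m P) t * a + algebraMap ℝ (L0 m P) t * algebraMap ℝ (L0 m P) t * b) :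
    0 ≤ a := by
  have h : ∀ᵐ ω ∂P, ∀ n : ℕ, 0 ≤ (a : Ω →ₘ[P] ℝ) ω + 1 / ((n : ℝ) + 1) * (b : Ω →ₘ[P] ℝ) ω := by
    refine ae_all_iff.2 fun n => ?_
    have hn : (0 : ℝ) < 1 / ((n : ℝ) + 1) := by positivity
    have h0 := L0.nonneg_iff.1 (hb _ hn)
    set t := 1 / ((n : ℝ) + 1)
    set T := algebraMap ℝ (L0 m P) t
    filter_upwards [h0, L0.coeFn_add (T * a) (T * T * b), L0.coeFn_mul T a,
      L0.coeFn_mul (T * T) b, L0.coeFn_mul T T, L0.coeFn_algebraMap (m := m) (P := P) t]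
      with ω h1 h2 h3 h4 h5 h6
    rw [h2, h3, h4, h5, h6] at h1
    refine nonneg_of_mul_nonneg_right (a := t) ?_ hn
    linarith
  rw [L0.nonneg_iff]
  filter_upwards [h] with ω h
  refine ge_of_tendsto' (f := fun n : ℕ => (a : Ω →ₘ[P] ℝ) ω +
    1 / ((n : ℝ) + 1) * (b : Ω →ₘ[P] ℝ) ω) (x := atTop) ?_ h
  simpa using tendsto_const_nhds.add
    ((tendsto_one_div_add_atTop_nhds_zero_nat (𝕜 := ℝ)).mul_const ((b : Ω →ₘ[P] ℝ) ω))

variable [IsProbabilityMeasure P]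

theorem map_mk_smul {M : Submodule (L0 m P) (L2 m P)} (π : M →ₗ[L0 m P] L0 m P) {h : L2 m P}
    (hh : h ∈ M) (c : L0 m P) : π ⟨c • h, M.smul_mem c hh⟩ = c * π ⟨h, hh⟩ :=
  π.map_smul c ⟨h, hh⟩

theorem map_mk_add_smul {M : Submodule (L0 m P) (L2 m P)} (π : M →ₗ[L0 m P] L0 m P) {x h : L2 m P}
    (hx : x ∈ M) (hh : h ∈ M) (c : L0 m P) :
    π ⟨x + c • h, M.add_mem hx (M.smul_mem c hh)⟩ = π ⟨x, hx⟩ + c * π ⟨h, hh⟩ :=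
  (π.map_add ⟨x, hx⟩ ⟨c • h, M.smul_mem c hh⟩).trans (congrArg _ (map_mk_smul π hh c))

theorem L2.pos_mem {M : Submodule (L0 m P) (L2 m P)}
    (habs : ∀ x ∈ M, ∃ z ∈ M, (z : Ω →ₘ[P] ℝ) = |(x : Ω →ₘ[P] ℝ)|) {x : L2 m P} (hx : x ∈ M) :
    L2.pos x ∈ M := by
  obtain ⟨z, hz, hzx⟩ := habs x hx
  have h : L2.pos x = algebraMap ℝ (L0 m P) (1 / 2) • (x + z) := by
    apply Subtype.ext
    apply AEEqFun.ext
    rw [L2.coe_smul, Submodule.coe_add, hzx]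
    filter_upwards [L2.coeFn_pos x, AEEqFun.coeFn_mul
      ((algebraMap ℝ (L0 m P) (1 / 2) : L0 m P) : Ω →ₘ[P] ℝ)
      ((x : Ω →ₘ[P] ℝ) + |(x : Ω →ₘ[P] ℝ)|), AEEqFun.coeFn_add (x : Ω →ₘ[P] ℝ) |(x : Ω →ₘ[P] ℝ)|,
      AEEqFun.coeFn_abs (x : Ω →ₘ[P] ℝ), L0.coeFn_algebraMap (m := m) (P := P) (1 / 2)]
      with ω h1 h2 h3 h4 h5
    rw [h1, h2, Pi.mul_apply, h3, Pi.add_apply, h4, h5]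
    grind
  rw [h]
  exact M.smul_mem _ (M.add_mem hx hz)

theorem inf_eq_sub_pos (x : L2 m P) (k : L0 m P) : (x : Ω →ₘ[P] ℝ) ⊓ (k : Ω →ₘ[P] ℝ) =
    (k : Ω →ₘ[P] ℝ) - (L2.pos (k • ofL0 1 - x) : Ω →ₘ[P] ℝ) := by
  rw [← ofL0_eq_smul]
  apply AEEqFun.ext
  filter_upwards [L2.coeFn_pos (ofL0 k - x), AEEqFun.coeFn_inf (x : Ω →ₘ[P] ℝ) (k : Ω →ₘ[P] ℝ),
    AEEqFun.coeFn_sub (k : Ω →ₘ[P] ℝ) (x : Ω →ₘ[P] ℝ),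
    AEEqFun.coeFn_sub (k : Ω →ₘ[P] ℝ) (L2.pos (ofL0 k - x) : Ω →ₘ[P] ℝ)] with ω h1 h2 h3 h4
  rw [h2, h4, Pi.sub_apply, h1, AddSubgroupClass.coe_sub, coe_ofL0, h3, Pi.sub_apply]
  grind

/-- The gradient -β(k-x)⁺ is built from x and an element of L⁰(ℱ) by module operations and a
positive part, under which a sublattice M is closed. -/
theorem gradient_mem_of_sublattice {M : Submodule (L0 m P) (L2 m P)}
    (habs : ∀ x ∈ M, ∃ z ∈ M, (z : Ω →ₘ[P] ℝ) = |(x : Ω →ₘ[P] ℝ)|)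
    (hML0 : ∀ ξ : L0 m P, ofL0 ξ ∈ M) (β : ℝ) {x : L2 m P} (hx : x ∈ M) : gradient β x ∈ M :=
  M.neg_mem (M.smul_mem _ (L2.pos_mem habs (M.sub_mem (M.smul_mem _ (hML0 1)) hx)))

variable (hm : m ≤ m0)
include hm

theorem ip_gradient_one {β : ℝ} (hβ : 0 < β) (x : L2 m P) : ip (gradient β x) (ofL0 1) = -1 :=
  (mem_dualSet_iff.1 (gradient_mem hm hβ x)).2

/-- Moving along ker π stays in R_π, so minimality and the quadratic upper bound give 0 ≤ tE[gh | ℱ]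
+ t²βE[h² | ℱ] for all t > 0. -/
theorem IsSolution.ip_gradient_nonneg {β : ℝ} (hβ : 0 < β) {M : Submodule (L0 m P) (L2 m P)}
    {π : M →ₗ[L0 m P] L0 m P} {x : L2 m P} (hx : IsSolution β M π x) {h : L2 m P} (hM : h ∈ M)
    (hh : π ⟨h, hM⟩ = 0) : 0 ≤ ip (gradient β x) h := by
  refine L0.nonneg_of_forall_mul_add_sq (b := algebraMap ℝ (L0 m P) β * ip h h)
    fun t ht => ?_
  obtain ⟨⟨hxM, hπx⟩, hmin⟩ := hx
  set T := algebraMap ℝ (L0 m P) t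
  have hret : x + T • h ∈ returns M π :=
    ⟨M.add_mem hxM (M.smul_mem _ hM), by
      rw [map_mk_add_smul π hxM hM, hπx, hh, mul_zero, add_zero]⟩
  have h1 := (sub_nonneg.2 (hmin hret)).trans (le_ip_gradient_add hm hβ x (T • h))
  refine h1.trans_eq ?_
  simp only [ip_smul_left hm, ip_smul_right hm]
  ring

theorem IsSolution.ip_gradient_eq {β : ℝ} (hβ : 0 < β) {M : Submodule (L0 m P) (L2 m P)}
    {π : M →ₗ[L0 m P] L0 m P} (hML0 : ∀ ξ : L0 m P, ofL0 ξ ∈ M) {rf : L0 m P}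
    (hπrf : π ⟨ofL0 rf, hML0 rf⟩ = 1) {x : L2 m P} (hx : IsSolution β M π x) (h : M) :
    ip (gradient β x) h = -(rf * π h) := by
  -- Subtracting π(h)r^f projects h onto ker π. Testing this vector and its negative makes the
  -- pairing with the gradient vanish.
  have hM : (h : L2 m P) + (-π h) • ofL0 rf ∈ M := M.add_mem h.2 (M.smul_mem _ (hML0 rf))
  have h0 : π ⟨_, hM⟩ = 0 := by
    rw [map_mk_add_smul π h.2 (hML0 rf), hπrf, mul_one]
    exact add_neg_cancel _
  have h1 := hx.ip_gradient_nonneg hm hβ hM h0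
  have h2 := hx.ip_gradient_nonneg hm hβ (M.smul_mem (-1) hM)
    (by rw [map_mk_smul π hM, h0, mul_zero])
  rw [ip_smul_right hm, neg_one_mul] at h2
  have h3 := le_antisymm (neg_nonneg.1 h2) h1
  rw [ofL0_eq_smul rf, ip_add_right, ip_smul_right hm, ip_smul_right hm,
    ip_gradient_one hm hβ] at h3
  linear_combination h3

/-- On R_π the linear term E[g(x)(y-x) | ℱ] of the subgradient inequality vanishes, because π(x) =
π(y) = 1. -/
theorem isSolution_of_ip_gradient_eq {β : ℝ} (hβ : 0 < β) {M : Submodule (L0 m P) (L2 m P)}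
    {π : M →ₗ[L0 m P] L0 m P} {rf : L0 m P} {x : L2 m P} (hx : x ∈ returns M π)
    (h : ∀ h : M, ip (gradient β x) h = -(rf * π h)) : IsSolution β M π x := by
  refine ⟨hx, fun y hy => ?_⟩
  obtain ⟨hxM, hπx⟩ := hx
  obtain ⟨hyM, hπy⟩ := hy
  have h1 := ip_gradient_le hm hβ x (y - x)
  have h2 := h ⟨x, hxM⟩
  have h3 := h ⟨y, hyM⟩
  rw [hπx] at h2
  rw [hπy] at h3
  rw [ip_sub_right hm, add_sub_cancel, h2, h3, sub_self] at h1
  exact sub_nonneg.1 h1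

theorem isSolution_iff {β : ℝ} (hβ : 0 < β) {M : Submodule (L0 m P) (L2 m P)}
    {π : M →ₗ[L0 m P] L0 m P} (hML0 : ∀ ξ : L0 m P, ofL0 ξ ∈ M) {rf : L0 m P}
    (hrf : ∀ᵐ ω ∂P, 0 < (rf : Ω →ₘ[P] ℝ) ω)
    (hπrf : π ⟨ofL0 rf, hML0 rf⟩ = 1) {x : L2 m P} (hx : x ∈ returns M π) :
    IsSolution β M π x ↔ (-recip rf) • (gateauxDeriv (monMeanVar β) x).domRestrict M = π := by
  have hr := recip_mul_self hrf
  rw [gateauxDeriv_monMeanVar hm hβ, LinearMap.ext_iff]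
  have key : ∀ h : M, ((-recip rf) • (ipLinear hm (gradient β x)).domRestrict M) h =
      -recip rf * ip (gradient β x) h := fun h => rfl
  simp only [key]
  constructor
  · intro hs h
    rw [hs.ip_gradient_eq hm hβ hML0 hπrf h]
    linear_combination π h * hr
  · intro hh
    refine isSolution_of_ip_gradient_eq hm hβ hx (rf := rf) fun h => ?_
    rw [← hh h]
    linear_combination -ip (gradient β x) h * hr

theorem IsSolution.eq_of_sublattice {β : ℝ} (hβ : 0 < β) {M : Submodule (L0 m P) (L2 m P)}
    {π : M →ₗ[L0 m P] L0 m P} (hML0 : ∀ ξ : L0 m P, ofL0 ξ ∈ M) {rf : L0 m P}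
    (hπrf : π ⟨ofL0 rf, hML0 rf⟩ = 1)
    (habs : ∀ x ∈ M, ∃ z ∈ M, (z : Ω →ₘ[P] ℝ) = |(x : Ω →ₘ[P] ℝ)|) {x y : L2 m P}
    (hx : IsSolution β M π x) (hy : IsSolution β M π y) :
    (x : Ω →ₘ[P] ℝ) ⊓ (kOf β x : Ω →ₘ[P] ℝ) = (y : Ω →ₘ[P] ℝ) ⊓ (kOf β y : Ω →ₘ[P] ℝ) ∧
      kOf β x = kOf β y := by
  obtain ⟨hxM, hπx⟩ := hx.1
  obtain ⟨hyM, hπy⟩ := hy.1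
  have hgx := gradient_mem_of_sublattice habs hML0 β hxM
  have hgy := gradient_mem_of_sublattice habs hML0 β hyM
  have hg : gradient β x = gradient β y := by
    -- The difference of the gradients lies in M, where both represent -r^f π; tested against itself
    -- it must vanish.
    rw [← sub_eq_zero]
    refine ip_self_eq_zero hm ?_
    rw [ip_sub_left hm, sub_eq_zero]
    exact (hx.ip_gradient_eq hm hβ hML0 hπrf ⟨_, M.sub_mem hgx hgy⟩).trans
      (hy.ip_gradient_eq hm hβ hML0 hπrf ⟨_, M.sub_mem hgx hgy⟩).symm
  have hxy : ip (gradient β x) x = ip (gradient β x) y := by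
    have h1 := hx.ip_gradient_eq hm hβ hML0 hπrf ⟨x, hxM⟩
    have h2 := hx.ip_gradient_eq hm hβ hML0 hπrf ⟨y, hyM⟩
    rw [hπx] at h1
    rw [hπy] at h2
    exact h1.trans h2.symm
  have hB := L0.algebraMap_mul_inv (m := m) (P := P) hβ
  have hp : L2.pos (kOf β x • ofL0 1 - x) = L2.pos (kOf β y • ofL0 1 - y) := by
    have h := congrArg (fun z => algebraMap ℝ (L0 m P) β⁻¹ • z) (neg_injective hg)
    rw [mul_comm] at hB
    simpa only [smul_smul, hB, one_smul] using h
  have hk : kOf β x = kOf β y := by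
    -- Since z = k - (k-z)⁺ + (z-k)⁺, the gradient at z is orthogonal to (z-k)⁺ and has conditional
    -- mean -1, its pairing with z expresses k through data common to both solutions.
    have e : ∀ z : L2 m P, ip (gradient β z) z =
        -kOf β z - ip (gradient β z) (L2.pos (kOf β z • ofL0 1 - z)) := by
      intro z
      have h1 := L2.pos_sub_pos_neg (kOf β z • ofL0 1 - z)
      have h2 : ip (gradient β z) (L2.pos (-(kOf β z • ofL0 1 - z))) = 0 := by
        rw [gradient, dualOpt, ip_neg_left hm, ip_smul_left hm, L2.ip_pos_pos_neg hm, mul_zero,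
          neg_zero]
      have h3 := congrArg (fun u => ip (gradient β z) u) h1
      simp only [ip_sub_right hm, ip_smul_right hm, ip_gradient_one hm hβ, h2] at h3
      linear_combination h3
    have ey := e y
    rw [← hg, ← hp] at ey
    linear_combination e x - ey - hxy
  exact ⟨by rw [inf_eq_sub_pos, inf_eq_sub_pos, hp, hk], hk⟩

theorem isRieszRep_ipLinear {N : Submodule (L0 m P) (L2 m P)} {v : L2 m P} (hv : v ∈ N) :
    IsRieszRep N ((ipLinear hm v).domRestrict N) v :=
  ⟨hv, fun _ => rfl⟩

theorem IsRieszRep.unique {N : Submodule (L0 m P) (L2 m P)} {φ : N →ₗ[L0 m P] L0 m P}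
    {v w : L2 m P} (hv : IsRieszRep N φ v) (hw : IsRieszRep N φ w) : v = w := by
  rw [← sub_eq_zero]
  refine ip_self_eq_zero hm ?_
  rw [ip_sub_left hm, sub_eq_zero]
  exact (hv.2 ⟨_, N.sub_mem hv.1 hw.1⟩).symm.trans (hw.2 ⟨_, N.sub_mem hv.1 hw.1⟩)

end Solutions

end RandomL2

end

/-! ### The main theorem -/

theorem theorem4p6 {Ω : Type*} {m m0 : MeasurableSpace Ω} (hm : m ≤ m0) (P : Measure[m0] Ω)
    [IsProbabilityMeasure P] (β : ℝ) (hβ : 0 < β)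
    (M : Submodule (L0 m P) (L2 m P))
    (hMclosed : IsClosed[epsLam P (l2norm (m := m) (P := P))] (M : Set (L2 m P)))
    (π : M →ₗ[L0 m P] L0 m P) (hπ : InConjugate M π)
    (hML0 : ∀ ξ : L0 m P, ofL0 ξ ∈ M)
    (rf : L0 m P) (hrf : ∀ᵐ ω ∂P, 0 < (rf : Ω →ₘ[P] ℝ) ω) (hπrf : π ⟨ofL0 rf, hML0 rf⟩ = 1) :
    -- the objects in the statement are well defined
    ((∀ y ∈ dualSet m P, IsLUB (meanVarConjSet β y) (meanVarConj β y)) ∧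
      ∀ x : L2 m P, IsLUB (monMeanVarSet β x) (monMeanVar β x) ∧
        HasGateauxDeriv (monMeanVar β) x (gateauxDeriv (monMeanVar β) x) ∧
        (IsK β x (kOf β x) ∧ ∀ k, IsK β x k → k = kOf β x)) ∧
    -- characterization of the solutions
    (∀ x ∈ returns M π, IsSolution β M π x ↔
      (-recip rf) • (gateauxDeriv (monMeanVar β) x).domRestrict M = π) ∧
    -- the case of a sublattice
    ((∀ x ∈ M, ∃ z ∈ M, (z : Ω →ₘ[P] ℝ) = |(x : Ω →ₘ[P] ℝ)|) →
      (∀ x y : L2 m P, IsSolution β M π x → IsSolution β M π y →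
        (x : Ω →ₘ[P] ℝ) ⊓ (kOf β x : Ω →ₘ[P] ℝ) = (y : Ω →ₘ[P] ℝ) ⊓ (kOf β y : Ω →ₘ[P] ℝ) ∧
          kOf β x = kOf β y) ∧
      ∀ x : L2 m P, IsSolution β M π x →
        ∃ v : L2 m P, IsRieszRep ⊤ ((gateauxDeriv (monMeanVar β) x).domRestrict ⊤) v ∧
          IsRieszRep M ((gateauxDeriv (monMeanVar β) x).domRestrict M) v ∧
          ∀ w, IsRieszRep M ((gateauxDeriv (monMeanVar β) x).domRestrict M) w → w = v) := by
  refine ⟨⟨fun y hy => meanVarConj_isLUB hm hβ hy, fun x =>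
    ⟨monMeanVar_isLUB hm hβ (isK_kOf hm hβ x), ?_, isK_kOf hm hβ x,
      fun k hk => hk.unique hm hβ (isK_kOf hm hβ x)⟩⟩,
    fun x hx => isSolution_iff hm hβ hML0 hrf hπrf hx, fun habs =>
    ⟨fun x y hx hy => hx.eq_of_sublattice hm hβ hML0 hπrf habs hy, fun x hx => ?_⟩⟩
  · rw [gateauxDeriv_monMeanVar hm hβ]
    exact hasGateauxDeriv_ipLinear hm hβ x
  · rw [gateauxDeriv_monMeanVar hm hβ]
    obtain ⟨hxM, -⟩ := hx.1
    have h := isRieszRep_ipLinear hm (gradient_mem_of_sublattice habs hML0 β hxM)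
    exact ⟨gradient β x, isRieszRep_ipLinear hm Submodule.mem_top, h,
      fun w hw => hw.unique hm h⟩
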